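/- Let $\mathcal X$ be a countable set and $\mathcal F,\mathcal H\subseteq\{\pm1\}^{\mathcal X}$ with $\mathcal F\neq\emptyset$. For a distribution $\mathcal D$ on $\mathcal X\times\{\pm1\}$ and $h:\mathcal X\to\{\pm1\}$ let $\mathrm{err}_{\mathcal D}(h)=\Pr_{(x,y)\sim\mathcal D}[h(x)\ne y]$ and $\mathrm{corr}_{\mathcal D}(h)=\mathbb E_{(x,y)\sim\mathcal D}[y\,h(x)]$. Put $\mathrm{Ln}(x)=\ln\max\{x,e\}$ and let $\mathrm{sign}(0)=1$. Let $d$ be the (finite) VC dimension of $\mathcal H$ and $d^*$ its dual VC dimension, i.e. the VC dimension of the class of evaluations $h\mapsto h(x)$ on $\mathcal H$, $x\in\mathcal X$. Let $\gamma_0,\varepsilon_0,\delta_0\in(0,1)$ with $\gamma_0>\varepsilon_0$, let $m_0\ge1$ be an integer, and $\theta=(\gamma_0-\varepsilon_0)/2$. Let $\mathcal W$ be a $(\gamma_0,\varepsilon_0,\delta_0,m_0)$ agnostic weak learner for $\mathcal F$ with base class $\mathcal H$: a map that takes a finite sequence of examples and a random seed $b\sim\mathcal U$ to an element of $\mathcal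 H$, such that for every distribution $\mathcal D'$ on $\mathcal X\times\{\pm1\}$, with probability at least $1-\delta_0$ over $S'\sim\mathcal D'^{m_0}$ and $b\sim\mathcal U$ (independent), $\mathrm{corr}_{\mathcal D'}(\mathcal W(S',b))\ge\gamma_0\sup_{f\in\mathcal F}\mathrm{corr}_{\mathcal D'}(f)-\varepsilon_0$. Let $\delta\in(0,1)$, let $n\ge2$ be even, and let $R=\lceil \ln n/\theta^2\rceil$, $M=\lceil\ln(5R/\delta)/\ln(1/\delta_0)\rceil$ and $$T=\Big\lceil\min\Big\{\frac{\ln n}{\theta^2},\ \frac{260^2(4d^*+2)}{\theta^2}\Big\}\Big\rceil,\qquad d'=4Td\ln(4eT).$$ Consider the following algorithm, on input a sample $S=((x_1,y_1),\dots,(x_n,y_n))$. Let $S_1$ and $S_2$ be its first and second halves. For every $r\in\{1,\dots,R\}$, every index vector $I\in\{1,\dots,n/2\}^{m_0}$ and every $m\in\{1,\dots,M\}$, draw an independent seed $b_{r,m,I}\sim\mathcal U$ and call $\mathcal W$ on the subsample of $S_1$ indexed by $I$ with this seed. Let $\mathcal B$ be the set of all hypotheses obtained. By exhaustive search over all $T$-tuples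 of them, return a minimizer $v$ of the empirical error on $S_2$ over all classifiers $\mathrm{sign}\big(\frac1T\sum_{t=1}^T h_t\big)$ with $h_1,\dots,h_T\in\mathcal B$. Then for every distribution $\mathcal D$ on $\mathcal X\times\{\pm1\}$, with probability at least $1-\delta$ over $S\sim\mathcal D^n$ and the seeds, the returned classifier (however ties between minimizers are broken) satisfies $$\mathrm{err}_{\mathcal D}(v)\le \mathrm{err}^*+10\sqrt{\mathrm{err}^*\cdot\frac{d'\,\mathrm{Ln}(10en/d')+\ln(5/\delta)}{n}}+182\cdot\frac{d'\,\mathrm{Ln}(10en/d')+4\ln(5/\delta)}{n},$$ where $\mathrm{err}^*=\inf_{f\in\mathcal F}\mathrm{err}_{\mathcal D}(f)$ and $d'\,\mathrm{Ln}(10en/d')$ is read as $0$ if $d'=0$. Moreover, for every $c>0$ there are constants $C,K>0$ that depend only on $c$ and $\delta_0$, such that whenever $n\ge c\cdot\max\{\max\{d,1\}\,T,\ \ln(1/\delta)\}$, on every sample and for all seeds the algorithm calls $\mathcal W$ at most $C\,n^{m_0+3}$ times and runs in at most $$\mathrm{Eval}_{\mathcal H}(1)\cdot n^{K\, m_0\min\{\max\{d^*,1\},\,\ln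 n\}/\theta^2}$$ steps. Here $\mathrm{Eval}_{\mathcal H}(1)\ge1$ is the number of steps for evaluating one hypothesis from $\mathcal H$ at one point; a call to $\mathcal W$, an arithmetic operation, a comparison, and the copying or storing of one item each count as one step. -/

import Mathlib

open MeasureTheory

universe u v

noncomputable section

/-! Labels are the two units `1, -1` of `ℤ`, so a classifier is a function `X → ℤˣ` and a
hypothesis class is a set of such functions. -/

/-! ### VC dimension and dual class -/

/-- `C` shatters the finite set `s`: every labelling of `s` is realized by a member of `C`. -/
def Shattered {A : Type*} (C : Set (A → ℤˣ)) (s : Finset A) : Prop :=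
  ∀ y : A → ℤˣ, ∃ h ∈ C, ∀ a ∈ s, h a = y a

/-- The VC dimension: the supremum of the sizes of the finite shattered sets. -/
def VCdim {A : Type*} (C : Set (A → ℤˣ)) : ℕ∞ :=
  ⨆ (s : Finset A) (_ : Shattered C s), (s.card : ℕ∞)

/-- The dual class of `H`: the evaluations `h ↦ h x` on `H`, for the points `x`. -/
def dualClass {X : Type*} (H : Set (X → ℤˣ)) : Set (H → ℤˣ) :=
  {g | ∃ x : X, g = fun h : H => h.1 x}

/-! ### Error, correlation, weak learners -/

/-- The value of a label as a real number, `1` or `-1`. -/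
def labelVal (y : ℤˣ) : ℝ := ((y : ℤ) : ℝ)

/-- The sign, with `sgn 0 = 1`. -/
def sgn (r : ℝ) : ℤˣ := if 0 ≤ r then 1 else -1

/-- `Ln x = ln (max {x, e})`. -/
def Ln (x : ℝ) : ℝ := Real.log (max x (Real.exp 1))

/-- The population error of a classifier. -/
def err {X : Type*} [MeasurableSpace X] (D : Measure (X × ℤˣ)) (h : X → ℤˣ) : ℝ :=
  D.real {z | h z.1 ≠ z.2}

/-- The population correlation of a classifier. -/
def corr {X : Type*} [MeasurableSpace X] (D : Measure (X × ℤˣ)) (h : X → ℤˣ) : ℝ :=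
  ∫ z, labelVal (h z.1) * labelVal z.2 ∂D

open Classical in
/-- The empirical error of a classifier on a finite sequence of examples. -/
def empErr {X : Type*} {k : ℕ} (S : Fin k → X × ℤˣ) (h : X → ℤˣ) : ℝ :=
  ((Finset.univ.filter fun i => h (S i).1 ≠ (S i).2).card : ℝ) / k

/-- A randomized learner: it maps a finite sequence of examples and a random seed in `B` to a
classifier. -/
abbrev Learner (X B : Type*) := (m : ℕ) → (Fin m → X × ℤˣ) → B → X → ℤˣ

/-- `W` is a `(γ₀, ε₀, δ₀, m₀)` agnostic weak learner for the reference class `F` with base class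
`H`, where its random seeds are drawn from `U`. -/
structure IsAgnosticWeakLearner {X B : Type*} [MeasurableSpace X] [MeasurableSpace B]
    (F H : Set (X → ℤˣ)) (γ₀ ε₀ δ₀ : ℝ) (m₀ : ℕ) (U : Measure B) (W : Learner X B) : Prop where
  mem_base : ∀ m S b, W m S b ∈ H
  measurable_seed : ∀ m S x, Measurable fun b => W m S b x
  guarantee : ∀ D : Measure (X × ℤˣ), IsProbabilityMeasure D →
    1 - δ₀ ≤ ((Measure.pi fun _ : Fin m₀ => D).prod U).real
      {p | γ₀ * (⨆ f : F, corr D f) - ε₀ ≤ corr D (W m₀ p.1 p.2)}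

/-! ### Parameters of the boosting algorithm, and its set of admissible outputs -/

/-- `R`, the number of rounds. -/
def numRounds (n : ℕ) (θ : ℝ) : ℕ := ⌈Real.log n / θ ^ 2⌉₊

/-- `M`, the number of hypotheses per round and subsample. -/
def numRepeats (n : ℕ) (θ δ δ₀ : ℝ) : ℕ :=
  ⌈Real.log (5 * numRounds n θ / δ) / Real.log (1 / δ₀)⌉₊

/-- `T`, the number of hypotheses in a combination. -/
def numCombined (n : ℕ) (θ : ℝ) (dstar : ℕ) : ℕ :=
  ⌈min (numRounds n θ : ℝ) (260 ^ 2 * ((4 * dstar + 2) / θ ^ 2))⌉₊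

/-- The indices `(r, I, m)` of the weak learner calls. -/
abbrev CallIndex (n m₀ : ℕ) (θ δ δ₀ : ℝ) :=
  Fin (numRounds n θ) × (Fin m₀ → Fin (n / 2)) × Fin (numRepeats n θ δ δ₀)

/-- The first `n / 2` entries of a sequence. -/
def firstHalf {Z : Type*} {n : ℕ} (S : Fin n → Z) : Fin (n / 2) → Z :=
  fun i => S ⟨i, by omega⟩

/-- The next `n / 2` entries of a sequence. -/
def secondHalf {Z : Type*} {n : ℕ} (S : Fin n → Z) : Fin (n / 2) → Z :=
  fun i => S ⟨n / 2 + i, by omega⟩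

/-- The sign of the average of `T` classifiers. -/
def signAvg {X : Type*} {T : ℕ} (f : Fin T → X → ℤˣ) : X → ℤˣ :=
  fun x => sgn ((1 / T : ℝ) * ∑ t, labelVal (f t x))

/-- The signs of the `T`-wise averages of members of `C`. -/
def signAvgClass {X : Type*} (T : ℕ) (C : Set (X → ℤˣ)) : Set (X → ℤˣ) :=
  {v | ∃ f : Fin T → X → ℤˣ, (∀ t, f t ∈ C) ∧ v = signAvg f}

/-- The members of `V` of least empirical error on `S`. -/
def ermSet {X : Type*} {k : ℕ} (S : Fin k → X × ℤˣ) (V : Set (X → ℤˣ)) : Set (X → ℤˣ) :=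
  {v | v ∈ V ∧ ∀ v' ∈ V, empErr S v ≤ empErr S v'}

/-- All hypotheses that the weak learner returns, over the rounds `r`, the index vectors `I` of
subsamples of the first half of the sample, and the repetitions `m`; `seed (r, I, m)` is the seed
used in call `(r, I, m)`. -/
def hypPool {X B : Type*} {n : ℕ} (S : Fin n → X × ℤˣ) (W : Learner X B) (m₀ : ℕ) (θ δ δ₀ : ℝ)
    (seed : CallIndex n m₀ θ δ δ₀ → B) : Set (X → ℤˣ) :=
  {h | ∃ r I m, h = W m₀ (fun j => firstHalf S (I j)) (seed (r, I, m))}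

/-- The classifiers that the algorithm may return (however ties between minimizers are broken). -/
def boostOutputs {X B : Type*} {n : ℕ} (S : Fin n → X × ℤˣ) (W : Learner X B) (m₀ : ℕ)
    (θ δ δ₀ : ℝ) (dstar : ℕ) (seed : CallIndex n m₀ θ δ δ₀ → B) : Set (X → ℤˣ) :=
  ermSet (secondHalf S)
    (signAvgClass (numCombined n θ dstar) (hypPool S W m₀ θ δ δ₀ seed))

/-! ### The boosting algorithm as a program with counted cost -/

/-- The outcome of a run: the value, the number of weak learner calls, the number of steps. -/
structure Counted (A : Type*) where
  val : A
  calls : ℕ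
  time : ℕ

namespace Counted

/-- Return a value, spending `t` steps. -/
def charge {A : Type*} (t : ℕ) (a : A) : Counted A := ⟨a, 0, t⟩

/-- Call the weak learner; the call itself counts as one step. -/
def callLearner {X B : Type*} (W : Learner X B) (m : ℕ) (S : Fin m → X × ℤˣ) (b : B) :
    Counted (X → ℤˣ) := ⟨W m S b, 1, 1⟩

/-- Sequential composition; the costs add up. -/
def bind {A : Type*} {A' : Type*} (c : Counted A) (k : A → Counted A') : Counted A' :=
  ⟨(k c.val).val, c.calls + (k c.val).calls, c.time + (k c.val).time⟩

/-- The loop over a list, which updates a state; loop control costs one step per iteration. -/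
def forEach {A St : Type*} : List A → (A → St → Counted St) → St → Counted St
  | [], _, s => charge 0 s
  | a :: l, body, s => ((charge 1 s).bind (body a)).bind (forEach l body)

/-- `k` nested loops over the list `l`: the body is run on all `k`-tuples of entries of `l`. -/
def forTuples {A St : Type*} (l : List A) :
    (k : ℕ) → ((Fin k → A) → St → Counted St) → St → Counted St
  | 0, body, s => body Fin.elim0 s
  | k + 1, body, s =>
      forEach l (fun a => forTuples l k fun I => body (Fin.cons a I)) s

end Counted

open Counted

/-- The first phase: collect the list of all hypotheses. In every pass of the subsample loop, the
`m₀` examples are copied, at a cost of `m₀` steps; in every pass of the innermost loop, a seed is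
drawn (one step), the weak learner is called, and its hypothesis is stored (one step). -/
def collectHyps {X B : Type*} {n : ℕ} (S : Fin n → X × ℤˣ) (W : Learner X B) (m₀ : ℕ)
    (θ δ δ₀ : ℝ) (seed : CallIndex n m₀ θ δ δ₀ → B) : Counted (List (X → ℤˣ)) :=
  forEach (List.finRange (numRounds n θ)) (fun r =>
    forTuples (List.finRange (n / 2)) m₀ fun I pool =>
      (charge m₀ fun j => firstHalf S (I j)).bind fun S' =>
        forEach (List.finRange (numRepeats n θ δ δ₀)) (fun m pool =>
          (charge 1 (seed (r, I, m))).bind fun b =>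
            (callLearner W m₀ S' b).bind fun h => charge 1 (h :: pool)) pool) []

/-- The sum of the votes of `T` hypotheses at the point `x`: evaluating one hypothesis at one point
costs `evalTime` steps, adding its vote costs one step. -/
def sumVotes {X : Type*} (evalTime : ℕ) {T : ℕ} (f : Fin T → X → ℤˣ) (x : X) : Counted ℤ :=
  forEach (List.finRange T) (fun t acc =>
    (charge evalTime (f t x)).bind fun y => charge 1 (acc + (y : ℤ))) 0

open Classical in
/-- The number of examples in `S` on which the sign of the average of `T` hypotheses errs; three
steps for taking the average, comparing its sign with the label, and updating the counter. -/
def countErrors {X : Type*} (evalTime : ℕ) {T k : ℕ} (f : Fin T → X → ℤˣ)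
    (S : Fin k → X × ℤˣ) : Counted ℕ :=
  forEach (List.finRange k) (fun i acc =>
    (sumVotes evalTime f (S i).1).bind fun z =>
      charge 3 (if sgn ((z : ℝ) / T) = (S i).2 then acc else acc + 1)) 0

/-- The second phase: exhaustive search over the `T`-tuples of entries of the list `pool`, with the
best combination so far and its number of errors as the state; `T + 2` steps for the comparison
and for updating the state. -/
def searchBest {X : Type*} (evalTime T : ℕ) {k : ℕ} (S : Fin k → X × ℤˣ)
    (pool : List (X → ℤˣ)) : Counted (Option ((X → ℤˣ) × ℕ)) :=
  forTuples pool T (fun f best =>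
    (countErrors evalTime f S).bind fun c =>
      charge (T + 2) (match best with
        | none => some (signAvg f, c)
        | some (v, c') => if c < c' then some (signAvg f, c) else some (v, c'))) none

/-- The agnostic boosting algorithm. Splitting the sample costs `n` steps, computing the three
parameters costs three; evaluating one hypothesis at one point costs `evalTime` steps. -/
def agnosticBoost {X B : Type*} (evalTime : ℕ) {n : ℕ} (S : Fin n → X × ℤˣ) (W : Learner X B)
    (m₀ : ℕ) (θ δ δ₀ : ℝ) (dstar : ℕ) (seed : CallIndex n m₀ θ δ δ₀ → B) :
    Counted (Option (X → ℤˣ)) :=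
  (charge (n + 3) ()).bind fun _ =>
    (collectHyps S W m₀ θ δ δ₀ seed).bind fun pool =>
      (searchBest evalTime (numCombined n θ dstar) (secondHalf S) pool).bind fun best =>
        charge 1 (best.map Prod.fst)

end

/-!
The error bound rests on one good member of the search space and on uniform convergence.

*A good member.* Fix `f ∈ F` that is nearly optimal for `D`. At the examples of the first half that
`f` labels correctly, `f` has correlation `1` with respect to every weighting, so that the guarantee
of the weak learner, applied to the weighted empirical distribution, provides a subsample on which
a call yields, with probability at least `1 - δ₀`, a hypothesis of edge at least
`γ₀ - ε₀ = 2 θ` (`exists_subsample_of_isAgnosticWeakLearner`). The algorithm tries all subsamples,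
`M` times each, with fresh seeds in every round. Hence the weights of a round may depend on the
outcomes of the earlier ones, and up to probability `R δ₀ ^ M ≤ δ / 5` multiplicative weights select
`R` hypotheses with average margin at least `7 θ / 16` at all these examples
(`measure_not_exists_margin_le`). If `T < R`, some `T` of them already have a positive total margin:
the class of evaluations has VC dimension `d*`, and by symmetrization and chaining, based on the
packing bound `log_card_le_of_separated`, the averages over `T` random members of the family are
uniformly close to the averages over the whole family as soon as `T` exceeds a multiple of
`d* / θ ^ 2`, without a logarithmic factor (`exists_uniform_approximation`). So the search space
contains a combination `v'` that is correct wherever `f` is correct on the first half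
(`measure_not_exists_consistent_le`).

*Uniform convergence.* A combination of `T` members of `H` has at most `(e n / d) ^ (d T)` traces on
`n` points, by the Sauer–Shelah lemma. For classes with few traces, symmetrization compares
frequencies and probabilities up to a relative error `η` (`measure_exists_deviation_le`). On the
first half this shows that `v'` is rarely wrong where `f` is correct, so that its error exceeds
that of `f` by at most a multiple of the excess error `x`. On the second half it is applied twice,
to bound the error of a minimizer `v` by its empirical error, and the empirical error of `v'` by its
error, with `η` of order `√(x / err*)`, which balances the two error terms
(`err_le_of_relative_deviations`).

*Cost.* The program is a nest of loops whose lengths are explicit, which determines the number of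
calls and bounds the running time (`agnosticBoost_calls`, `agnosticBoost_time_le`). For samples that
are large compared to `T` and `ln (1 / δ)`, the numbers `R` and `M` are polynomial in `n`, since
`1 / θ ^ 2` is at most a multiple of `T`; so each of the `T` nested loops of the search multiplies
the running time by `n ^ O(m₀)` (`exists_cost_bounds`).
-/

noncomputable section

/-! ### Traces and the growth function -/

/-- The restrictions of the members of `C` to the points `p j`, as labellings of the indices. -/
def traces {A ι : Type*} (C : Set (A → ℤˣ)) (p : ι → A) : Set (ι → ℤˣ) :=
  (fun g j => g (p j)) '' C

lemma Shattered.card_le {A : Type*} {C : Set (A → ℤˣ)} {s : Finset A} {d : ℕ}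
    (hs : Shattered C s) (hC : VCdim C ≤ d) : s.card ≤ d := by
  have h : (s.card : ℕ∞) ≤ VCdim C := le_iSup₂_of_le s hs le_rfl
  exact_mod_cast h.trans hC

/-- The Sauer–Shelah lemma for the traces of a class on a finite family of points. -/
lemma ncard_traces_le_sum_choose {A ι : Type*} [Fintype ι] {C : Set (A → ℤˣ)} {d : ℕ}
    (hC : VCdim C ≤ d) (p : ι → A) :
    (traces C p).ncard ≤ ∑ i ∈ Finset.range (d + 1), (Fintype.card ι).choose i := by
  classical
  set 𝒯 := (traces C p).toFinite.toFinset with h𝒯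
  have hmem : ∀ u, u ∈ 𝒯 ↔ ∃ g ∈ C, (fun j => g (p j)) = u := by
    intro u; simp [h𝒯, traces]
  let pos : (ι → ℤˣ) → Finset ι := fun u => Finset.univ.filter fun j => u j = 1
  have hpos : Function.Injective pos := by
    intro u w h
    funext j
    have hj : u j = 1 ↔ w j = 1 := by
      simpa [pos] using Finset.ext_iff.1 h j
    rcases Int.units_eq_one_or (u j) with h1 | h1 <;>
      rcases Int.units_eq_one_or (w j) with h2 | h2 <;> simp_all
  have hcard : (traces C p).ncard = (𝒯.image pos).card := by
    rw [Finset.card_image_of_injective _ hpos, Set.ncard_eq_toFinset_card _ (traces C p).toFinite]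
  have hdim : (𝒯.image pos).vcDim ≤ d := by
    refine Finset.sup_le fun s hs => ?_
    rw [Finset.mem_shatterer] at hs
    -- two indices of the same point get the same label, so `p` is injective on a shattered set
    have hinj : Set.InjOn p s := by
      intro a ha b hb hab
      by_contra hne
      obtain ⟨w, hw, hsw⟩ := hs (Finset.singleton_subset_iff.2 ha)
      obtain ⟨u, hu, rfl⟩ := Finset.mem_image.1 hw
      obtain ⟨g, -, rfl⟩ := (hmem u).1 hu
      have h1 : a ∈ s ∩ pos fun j => g (p j) := by rw [hsw]; simp
      have h2 : b ∉ s ∩ pos fun j => g (p j) := by rw [hsw]; simpa using fun h => hne h.symm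
      simp only [pos, Finset.mem_inter, Finset.mem_filter, Finset.mem_univ, true_and] at h1 h2
      exact h2 ⟨hb, hab ▸ h1.2⟩
    rw [← Finset.card_image_of_injOn hinj]
    refine Shattered.card_le (C := C) (fun y => ?_) hC
    obtain ⟨w, hw, hsw⟩ := hs (Finset.filter_subset (fun j => y (p j) = 1) s)
    obtain ⟨u, hu, rfl⟩ := Finset.mem_image.1 hw
    obtain ⟨g, hg, rfl⟩ := (hmem u).1 hu
    refine ⟨g, hg, fun a ha => ?_⟩
    obtain ⟨j, hj, rfl⟩ := Finset.mem_image.1 ha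
    have h := Finset.ext_iff.1 hsw j
    simp only [pos, Finset.mem_inter, Finset.mem_filter, Finset.mem_univ, true_and, hj] at h
    rcases Int.units_eq_one_or (g (p j)) with h1 | h1 <;>
      rcases Int.units_eq_one_or (y (p j)) with h2 | h2 <;> simp_all
  calc (traces C p).ncard ≤ (𝒯.image pos).shatterer.card :=
        hcard ▸ Finset.card_le_card_shatterer _
    _ ≤ ∑ i ∈ Finset.Iic (𝒯.image pos).vcDim, (Fintype.card ι).choose i :=
        Finset.card_shatterer_le_sum_vcDim
    _ ≤ ∑ i ∈ Finset.range (d + 1), (Fintype.card ι).choose i := by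
        refine Finset.sum_le_sum_of_subset fun i hi => ?_
        simp only [Finset.mem_Iic, Finset.mem_range] at hi ⊢
        omega

lemma sum_range_choose_le_pow {m d : ℕ} (hd : 1 ≤ d) (hdm : d ≤ m) :
    ((∑ i ∈ Finset.range (d + 1), m.choose i : ℕ) : ℝ) ≤ (Real.exp 1 * m / d) ^ d := by
  have hd0 : (0 : ℝ) < d := by exact_mod_cast hd
  have hm0 : (0 : ℝ) < m := by exact_mod_cast hd.trans hdm
  set x : ℝ := d / m with hx
  have hx0 : 0 < x := by positivity
  have hx1 : x ≤ 1 := by rw [hx, div_le_one hm0]; exact_mod_cast hdm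
  -- weight the term `i ≤ d` by `x ^ i / x ^ d ≥ 1`, and complete to the binomial sum
  have h1 : ((∑ i ∈ Finset.range (d + 1), m.choose i : ℕ) : ℝ) * x ^ d ≤ (x + 1) ^ m := by
    rw [add_pow]
    push_cast
    rw [Finset.sum_mul]
    calc ∑ i ∈ Finset.range (d + 1), (m.choose i : ℝ) * x ^ d
        ≤ ∑ i ∈ Finset.range (d + 1), x ^ i * 1 ^ (m - i) * (m.choose i : ℝ) := by
          refine Finset.sum_le_sum fun i hi => ?_
          rw [one_pow, mul_one, mul_comm]
          gcongr ?_ * _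
          exact pow_le_pow_of_le_one hx0.le hx1 (by simpa [Nat.lt_succ_iff] using hi)
      _ ≤ _ := Finset.sum_le_sum_of_subset_of_nonneg
          (Finset.range_mono (by omega)) (fun _ _ _ => by positivity)
  have h2 : (x + 1) ^ m ≤ Real.exp 1 ^ d := by
    calc (x + 1) ^ m ≤ Real.exp x ^ m := by gcongr; exact Real.add_one_le_exp x
      _ = Real.exp 1 ^ d := by
        rw [← Real.exp_nat_mul, ← Real.exp_nat_mul, hx]; congr 1; field_simp
  have h3 : (Real.exp 1 * m / d) ^ d = Real.exp 1 ^ d / x ^ d := by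
    rw [← div_pow, hx]; congr 1; field_simp
  rw [h3, le_div_iff₀ (by positivity)]
  exact h1.trans h2

/-- The Sauer–Shelah bound `(e m / d) ^ d` for the number of traces on `m ≥ d` points. -/
lemma ncard_traces_le_pow {A ι : Type*} [Fintype ι] {C : Set (A → ℤˣ)} {d : ℕ}
    (hC : VCdim C ≤ d) (hd : 1 ≤ d) (hdm : d ≤ Fintype.card ι) (p : ι → A) :
    ((traces C p).ncard : ℝ) ≤ (Real.exp 1 * Fintype.card ι / d) ^ d :=
  (Nat.cast_le.2 (ncard_traces_le_sum_choose hC p)).trans (sum_range_choose_le_pow hd hdm)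

lemma ncard_traces_le_one {A ι : Type*} [Fintype ι] {C : Set (A → ℤˣ)}
    (hC : VCdim C ≤ (0 : ℕ)) (p : ι → A) : (traces C p).ncard ≤ 1 := by
  simpa using ncard_traces_le_sum_choose hC p

lemma traces_comp {A ι κ : Type*} (C : Set (A → ℤˣ)) (p : ι → A) (q : κ → ι) :
    traces C (p ∘ q) = (fun u j => u (q j)) '' traces C p := by
  simp only [traces, Set.image_image, Function.comp]

/-! ### Packing numbers of a class of finite VC dimension -/

/-- Dudley's packing bound: a family of sign vectors, pairwise differing in more than a fraction `ε`
of the coordinates, whose growth is that of a class of VC dimension `d`, has at most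
`(4 e / ε) ^ (2 d)` members. Some `m ≈ 2 ln |A| / ε` coordinates, with repetitions, separate the
family, so that its size is bounded by the growth function at `m`. -/
lemma log_card_le_of_separated {T d : ℕ} (hd : 1 ≤ d) (A : Finset (Fin T → ℤˣ))
    (hA : ∀ m, d ≤ m → ∀ q : Fin m → Fin T,
      ((A.image fun u j => u (q j)).card : ℝ) ≤ (Real.exp 1 * m / d) ^ d)
    {ε : ℝ} (hε : 0 < ε) (hε1 : ε ≤ 1)
    (hsep : ∀ a ∈ A, ∀ b ∈ A, a ≠ b → ε * T < hammingDist a b) :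
    Real.log A.card ≤ 2 * d * Real.log (4 * Real.exp 1 / ε) := by
  have he : (1 : ℝ) ≤ Real.exp 1 := Real.one_le_exp zero_le_one
  have hd0 : (1 : ℝ) ≤ d := by exact_mod_cast hd
  have hrhs : 0 ≤ Real.log (4 * Real.exp 1 / ε) := by
    apply Real.log_nonneg
    rw [le_div_iff₀ hε]; nlinarith
  rcases le_or_gt A.card 1 with h1 | h1
  · have : Real.log A.card ≤ 0 := Real.log_nonpos (by positivity) (by exact_mod_cast h1)
    exact this.trans (by positivity)
  have hM : (1 : ℝ) < A.card := by exact_mod_cast h1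
  set M : ℝ := (A.card : ℝ) with hMdef
  have hlogM : 0 < Real.log M := Real.log_pos hM
  have hT : 0 < (T : ℝ) := by
    rcases Nat.eq_zero_or_pos T with h | h
    · subst h
      exact absurd (Finset.card_le_one_of_subsingleton A) (by omega)
    · exact_mod_cast h
  set m : ℕ := ⌊2 * Real.log M / ε⌋₊ + 1 + d with hm
  have hm1 : 2 * Real.log M / ε < m := by
    have := Nat.lt_floor_add_one (2 * Real.log M / ε)
    rw [hm]; push_cast; linarith
  have hm2 : (m : ℝ) ≤ 2 * Real.log M / ε + 1 + d := by
    have := Nat.floor_le (a := 2 * Real.log M / ε) (by positivity)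
    rw [hm]; push_cast; linarith
  -- the coordinates that separate the family
  obtain ⟨q, hq⟩ : ∃ q : Fin m → Fin T, Set.InjOn (fun (u : Fin T → ℤˣ) j => u (q j)) A := by
    by_contra hcon
    push Not at hcon
    -- count the sequences `q` that fail to separate a given pair
    let bad : (Fin T → ℤˣ) × (Fin T → ℤˣ) → Finset (Fin m → Fin T) := fun ab =>
      Fintype.piFinset fun _ => Finset.univ.filter fun i => ab.1 i = ab.2 i
    have hcover : (Finset.univ : Finset (Fin m → Fin T)) ⊆ A.offDiag.biUnion bad := by
      intro q _
      have := hcon q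
      simp only [Set.InjOn, not_forall] at this
      obtain ⟨a, ha, b, hb, hab, hne⟩ := this
      refine Finset.mem_biUnion.2 ⟨(a, b), Finset.mem_offDiag.2 ⟨ha, hb, hne⟩, ?_⟩
      refine Fintype.mem_piFinset.2 fun j => ?_
      simpa using congrFun hab j
    have hbad : ∀ ab ∈ A.offDiag, ((bad ab).card : ℝ) ≤ ((1 - ε) * T) ^ m := by
      rintro ⟨a, b⟩ hab
      obtain ⟨ha, hb, hne⟩ := Finset.mem_offDiag.1 hab
      have h2 : (Finset.univ.filter fun i => a i = b i).card + hammingDist a b = T := by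
        have := Finset.card_filter_add_card_filter_not (s := (Finset.univ : Finset (Fin T)))
          (fun i => a i = b i)
        simpa [hammingDist] using this
      have h3 : ((Finset.univ.filter fun i => a i = b i).card : ℝ) ≤ (1 - ε) * T := by
        have h4 : ((Finset.univ.filter fun i => a i = b i).card : ℝ) + hammingDist a b = T := by
          exact_mod_cast h2
        have := hsep a ha b hb hne
        linarith
      simp only [bad, Fintype.card_piFinset, Finset.prod_const, Finset.card_univ, Fintype.card_fin]
      push_cast
      gcongr
    have h5 : (T : ℝ) ^ m ≤ M ^ 2 * ((1 - ε) * T) ^ m := by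
      calc (T : ℝ) ^ m = ((Finset.univ : Finset (Fin m → Fin T)).card : ℝ) := by simp
        _ ≤ ((A.offDiag.biUnion bad).card : ℝ) := by exact_mod_cast Finset.card_le_card hcover
        _ ≤ ∑ ab ∈ A.offDiag, ((bad ab).card : ℝ) := by exact_mod_cast Finset.card_biUnion_le
        _ ≤ ∑ ab ∈ A.offDiag, ((1 - ε) * T) ^ m := Finset.sum_le_sum hbad
        _ = (A.offDiag.card : ℝ) * ((1 - ε) * T) ^ m := by simp
        _ ≤ M ^ 2 * ((1 - ε) * T) ^ m := by
          have h6 : (A.offDiag.card : ℝ) ≤ M ^ 2 := by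
            rw [hMdef, Finset.offDiag_card, sq]
            exact_mod_cast Nat.sub_le _ _
          have : 0 ≤ 1 - ε := by linarith
          gcongr
    have h7 : M ^ 2 * (1 - ε) ^ m < 1 := by
      calc M ^ 2 * (1 - ε) ^ m ≤ M ^ 2 * Real.exp (-ε) ^ m := by
            have : 0 ≤ 1 - ε := by linarith
            gcongr; exact Real.one_sub_le_exp_neg ε
        _ = Real.exp (2 * Real.log M - m * ε) := by
            rw [← Real.exp_nat_mul, sub_eq_add_neg, Real.exp_add, two_mul, Real.exp_add,
              Real.exp_log (by linarith), sq]
            congr 2; ring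
        _ < 1 := by
            rw [div_lt_iff₀ hε] at hm1
            rw [Real.exp_lt_one_iff]; linarith
    rw [mul_pow, ← mul_assoc] at h5
    have : 0 < (T : ℝ) ^ m := by positivity
    nlinarith
  -- compare with the growth function
  have h8 : M ≤ (Real.exp 1 * m / d) ^ d := by
    rw [hMdef, ← Finset.card_image_of_injOn hq]
    exact hA m (by omega) q
  set y : ℝ := Real.log M / d with hy
  have hy0 : 0 < y := by positivity
  have hdy : d * y = Real.log M := by rw [hy]; field_simp
  have h9 : Real.exp y ≤ 2 * Real.exp 1 / ε * (y + 1) := by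
    have h10 : Real.exp y ^ d ≤ (Real.exp 1 * m / d) ^ d := by
      rw [← Real.exp_nat_mul, hdy, Real.exp_log (by linarith)]; exact h8
    have h11 : Real.exp y ≤ Real.exp 1 * m / d :=
      le_of_pow_le_pow_left₀ (by omega) (by positivity) h10
    refine h11.trans ?_
    rw [← hdy] at hm2
    rw [div_mul_eq_mul_div, div_le_div_iff₀ (by linarith) hε]
    have h12 : 2 * (d * y) / ε * ε = 2 * (d * y) := by field_simp
    have h13 : m * ε ≤ 2 * (d * y) + (1 + d) * ε := by nlinarith
    have h13' : m * ε ≤ 2 * (y + 1) * d := by nlinarith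
    calc Real.exp 1 * m * ε = Real.exp 1 * (m * ε) := by ring
      _ ≤ Real.exp 1 * (2 * (y + 1) * d) := by gcongr
      _ = _ := by ring
  have h14 : Real.exp (y / 2) ≤ 4 * Real.exp 1 / ε := by
    have h15 : y + 1 ≤ 2 * Real.exp (y / 2) := by
      have := Real.add_one_le_exp (y / 2); linarith
    have h16 : Real.exp y = Real.exp (y / 2) * Real.exp (y / 2) := by
      rw [← Real.exp_add]; congr 1; ring
    have h17 : Real.exp (y / 2) * Real.exp (y / 2)
        ≤ 4 * Real.exp 1 / ε * Real.exp (y / 2) := by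
      rw [← h16]
      refine h9.trans ?_
      calc 2 * Real.exp 1 / ε * (y + 1) ≤ 2 * Real.exp 1 / ε * (2 * Real.exp (y / 2)) := by gcongr
        _ = _ := by ring
    exact le_of_mul_le_mul_right h17 (Real.exp_pos _)
  have h18 : y / 2 ≤ Real.log (4 * Real.exp 1 / ε) := by
    rw [Real.le_log_iff_exp_le (by positivity)]; exact h14
  rw [← hdy]
  nlinarith

/-! ### Chaining for Rademacher sums -/

lemma labelVal_one : labelVal 1 = 1 := by simp [labelVal]

lemma labelVal_neg_one : labelVal (-1) = -1 := by simp [labelVal]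

lemma abs_labelVal (y : ℤˣ) : |labelVal y| = 1 := by
  rcases Int.units_eq_one_or y with rfl | rfl <;> simp [labelVal]

lemma sum_units {M : Type*} [AddCommMonoid M] (f : ℤˣ → M) : ∑ y, f y = f 1 + f (-1) := by
  rw [show (Finset.univ : Finset ℤˣ) = {1, -1} from rfl, Finset.sum_pair (by decide)]

/-- The sum of the entries of `u` with the signs `σ`. -/
def radSum {T : ℕ} (σ : Fin T → ℤˣ) (u : Fin T → ℝ) : ℝ := ∑ j, labelVal (σ j) * u j

lemma sum_exp_radSum_le {T : ℕ} (l : ℝ) (u : Fin T → ℝ) :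
    ∑ σ : Fin T → ℤˣ, Real.exp (l * radSum σ u)
      ≤ 2 ^ T * Real.exp (l ^ 2 * (∑ j, u j ^ 2) / 2) := by
  have h1 : ∀ σ : Fin T → ℤˣ, Real.exp (l * radSum σ u)
      = ∏ j, Real.exp (l * (labelVal (σ j) * u j)) := by
    intro σ; rw [← Real.exp_sum, radSum, Finset.mul_sum]
  calc ∑ σ : Fin T → ℤˣ, Real.exp (l * radSum σ u)
      = ∏ j, ∑ y : ℤˣ, Real.exp (l * (labelVal y * u j)) := by
        rw [Finset.prod_univ_sum, Fintype.piFinset_univ]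
        exact Finset.sum_congr rfl fun σ _ => h1 σ
    _ ≤ ∏ j, 2 * Real.exp (l ^ 2 * u j ^ 2 / 2) := by
        refine Finset.prod_le_prod (fun _ _ => by positivity) fun j _ => ?_
        have := Real.cosh_le_exp_half_sq (l * u j)
        rw [Real.cosh_eq, mul_pow] at this
        rw [sum_units, labelVal_one, labelVal_neg_one]
        simp only [one_mul, neg_mul, mul_neg]
        linarith
    _ = _ := by
        rw [Finset.prod_mul_distrib, ← Real.exp_sum]
        simp only [Finset.prod_const, Finset.card_univ, Fintype.card_fin, ← Finset.sum_div,
          ← Finset.mul_sum]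

/-- The maximal inequality for finitely many Rademacher sums with coefficient vectors of squared
length at most `s`, for any `l > 0`; `f` is dominated by the maximum. -/
lemma sum_le_of_le_radSum {T : ℕ} {β : Type*} (B : Finset β) (u : β → Fin T → ℝ) {s l : ℝ}
    (hl : 0 < l) (hs : ∀ b ∈ B, ∑ j, u b j ^ 2 ≤ s) (f : (Fin T → ℤˣ) → ℝ)
    (hf : ∀ σ, ∃ b ∈ B, f σ ≤ |radSum σ (u b)|) :
    ∑ σ, f σ ≤ 2 ^ T * (Real.log (2 * B.card) / l + l * s / 2) := by
  have hB : 0 < (B.card : ℝ) := by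
    obtain ⟨b, hb, -⟩ := hf 1
    exact_mod_cast Finset.card_pos.2 ⟨b, hb⟩
  set E : ℝ := 2 * B.card * Real.exp (l ^ 2 * s / 2) with hE
  have hE0 : 0 < E := by positivity
  have hlogE : Real.log E = Real.log (2 * B.card) + l ^ 2 * s / 2 := by
    rw [hE, Real.log_mul (by positivity) (by positivity), Real.log_exp]
  have h1 : ∀ σ, Real.exp (l * f σ)
      ≤ ∑ b ∈ B, (Real.exp (l * radSum σ (u b)) + Real.exp (-l * radSum σ (u b))) := by
    intro σ
    obtain ⟨b, hb, hfb⟩ := hf σ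
    refine le_trans ?_ (Finset.single_le_sum (fun _ _ => by positivity) hb)
    rcases abs_cases (radSum σ (u b)) with h | h
    · have : Real.exp (l * f σ) ≤ Real.exp (l * radSum σ (u b)) := by
        apply Real.exp_le_exp.2; gcongr; rw [← h.1]; exact hfb
      have := Real.exp_pos (-l * radSum σ (u b)); linarith
    · have : Real.exp (l * f σ) ≤ Real.exp (-l * radSum σ (u b)) := by
        apply Real.exp_le_exp.2; rw [neg_mul, ← mul_neg]; gcongr; rw [← h.1]; exact hfb
      have := Real.exp_pos (l * radSum σ (u b)); linarith
  have h2 : ∑ σ, Real.exp (l * f σ) ≤ 2 ^ T * E := by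
    calc ∑ σ, Real.exp (l * f σ)
        ≤ ∑ σ, ∑ b ∈ B, (Real.exp (l * radSum σ (u b)) + Real.exp (-l * radSum σ (u b))) :=
          Finset.sum_le_sum fun σ _ => h1 σ
      _ = ∑ b ∈ B, (∑ σ, Real.exp (l * radSum σ (u b))
            + ∑ σ, Real.exp (-l * radSum σ (u b))) := by
          rw [Finset.sum_comm]; simp only [Finset.sum_add_distrib]
      _ ≤ ∑ b ∈ B, (2 * (2 ^ T * Real.exp (l ^ 2 * s / 2))) := by
          refine Finset.sum_le_sum fun b hb => ?_
          have h3 : (2 : ℝ) ^ T * Real.exp (l ^ 2 * (∑ j, u b j ^ 2) / 2)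
              ≤ 2 ^ T * Real.exp (l ^ 2 * s / 2) := by
            gcongr; exact hs b hb
          have h4 := sum_exp_radSum_le l (u b)
          have h5 := sum_exp_radSum_le (-l) (u b)
          rw [neg_sq] at h5
          linarith
      _ = 2 ^ T * E := by rw [hE, Finset.sum_const, nsmul_eq_mul]; ring
  -- the tangent to `log` at `E` replaces Jensen's inequality
  have h6 : ∀ σ, l * f σ ≤ Real.log E - 1 + Real.exp (l * f σ) / E := by
    intro σ
    have h7 := Real.log_le_sub_one_of_pos (x := Real.exp (l * f σ) / E) (by positivity)
    rw [Real.log_div (by positivity) (by positivity), Real.log_exp] at h7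
    linarith
  have h8 : l * ∑ σ, f σ ≤ 2 ^ T * Real.log E := by
    calc l * ∑ σ, f σ ≤ ∑ σ, (Real.log E - 1 + Real.exp (l * f σ) / E) := by
          rw [Finset.mul_sum]; exact Finset.sum_le_sum fun σ _ => h6 σ
      _ = 2 ^ T * (Real.log E - 1) + (∑ σ, Real.exp (l * f σ)) / E := by
          rw [Finset.sum_add_distrib, Finset.sum_div]
          simp [mul_sub]
      _ ≤ 2 ^ T * (Real.log E - 1) + 2 ^ T * E / E := by gcongr
      _ = 2 ^ T * Real.log E := by field_simp; ring
  rw [hlogE] at h8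
  have h9 : Real.log (2 * B.card) / l + l * s / 2
      = (Real.log (2 * B.card) + l ^ 2 * s / 2) / l := by field_simp
  rw [h9, mul_div_assoc', le_div_iff₀ hl]
  linarith

lemma sum_sq_sub_labelVal {T : ℕ} (a b : Fin T → ℤˣ) :
    ∑ j, (labelVal (a j) - labelVal (b j)) ^ 2 = 4 * hammingDist a b := by
  have : ∀ j, (labelVal (a j) - labelVal (b j)) ^ 2 = if a j ≠ b j then 4 else 0 := by
    intro j
    rcases Int.units_eq_one_or (a j) with h1 | h1 <;>
      rcases Int.units_eq_one_or (b j) with h2 | h2 <;>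
      simp [h1, h2, labelVal, units_ne_neg_self] <;> norm_num
  simp only [this, hammingDist]
  rw [← Finset.sum_filter, Finset.sum_const, nsmul_eq_mul, mul_comm]

/-- A maximal `r`-separated subset of a finite set of sign vectors is an `r`-net. -/
lemma exists_separated_net {T : ℕ} (A : Finset (Fin T → ℤˣ)) (r : ℝ) :
    ∃ C ⊆ A, (∀ a ∈ C, ∀ b ∈ C, a ≠ b → r < hammingDist a b) ∧
      (0 ≤ r → ∀ a ∈ A, ∃ b ∈ C, (hammingDist a b : ℝ) ≤ r) := by
  classical
  let 𝒮 := A.powerset.filter fun C => ∀ a ∈ C, ∀ b ∈ C, a ≠ b → r < hammingDist a b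
  obtain ⟨C, hC, hmax⟩ := Finset.exists_max_image 𝒮 Finset.card ⟨∅, by simp [𝒮]⟩
  obtain ⟨hCA, hsep⟩ : C ⊆ A ∧ ∀ a ∈ C, ∀ b ∈ C, a ≠ b → r < hammingDist a b := by
    simpa [𝒮] using hC
  refine ⟨C, hCA, hsep, fun hr a ha => ?_⟩
  by_contra! hcon
  have haC : a ∉ C := fun h => absurd (hcon a h) (by simpa using hr)
  have hin : insert a C ∈ 𝒮 := by
    simp only [𝒮, Finset.mem_filter, Finset.mem_powerset]
    refine ⟨Finset.insert_subset ha hCA, fun x hx y hy hxy => ?_⟩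
    rcases Finset.mem_insert.1 hx with hxa | hxC <;>
      rcases Finset.mem_insert.1 hy with hya | hyC
    · exact absurd (hxa.trans hya.symm) hxy
    · rw [hxa]; exact hcon y hyC
    · rw [hya, hammingDist_comm]; exact hcon x hxC
    · exact hsep x hxC y hyC hxy
  have := hmax _ hin
  rw [Finset.card_insert_of_notMem haC] at this
  omega

/-- The chaining step: the Rademacher complexity of the part of a class that is separated at the
scale `4 ^ (-k)`. A maximal separated set at the scale `4 ^ (-k)` is a net for the one at the scale
`4 ^ (-(k + 1))`, and the increments between the two contribute `2 ^ (-(k + 1)) * (3 * k + 17)`. -/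
lemma sum_le_of_separated {T d : ℕ} (hT : 1 ≤ T) (hd : 1 ≤ d) (A : Finset (Fin T → ℤˣ))
    (hA : ∀ m, d ≤ m → ∀ q : Fin m → Fin T,
      ((A.image fun u j => u (q j)).card : ℝ) ≤ (Real.exp 1 * m / d) ^ d) (k : ℕ) :
    ∀ B ⊆ A, (∀ a ∈ B, ∀ b ∈ B, a ≠ b → (1 / 4 : ℝ) ^ k * T < hammingDist a b) →
    ∀ f : (Fin T → ℤˣ) → ℝ, (∀ σ, ∃ a ∈ B, f σ ≤ |radSum σ fun j => labelVal (a j)|) →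
    ∑ σ, f σ ≤ 2 ^ T * (√d * √T * (22 - (1 / 2) ^ k * (3 * k + 20))) := by
  have hd1 : (1 : ℝ) ≤ √d := Real.one_le_sqrt.2 (by exact_mod_cast hd)
  have hT1 : (1 : ℝ) ≤ √T := Real.one_le_sqrt.2 (by exact_mod_cast hT)
  have hsd : √d * √d = d := Real.mul_self_sqrt (by positivity)
  have hsT : √T * √T = T := Real.mul_self_sqrt (by positivity)
  have hlog2 := Real.log_two_lt_d9
  induction k with
  | zero =>
    intro B hBA hsep f hf
    have hB : B.card ≤ 1 := by
      refine Finset.card_le_one.2 fun a ha b hb => ?_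
      by_contra hne
      have h1 := hsep a ha b hb hne
      have h2 : (hammingDist a b : ℝ) ≤ T := by
        exact_mod_cast hammingDist_le_card_fintype.trans_eq (Fintype.card_fin T)
      simp only [pow_zero, one_mul] at h1
      linarith
    have hB1 : B.card = 1 := by
      obtain ⟨b, hb, -⟩ := hf 1
      exact le_antisymm hB (Finset.card_pos.2 ⟨b, hb⟩)
    have h := sum_le_of_le_radSum B (fun a j => labelVal (a j)) (s := T) (l := 1 / √T)
      (by positivity) (fun b _ => by simp [← sq_abs (labelVal _), abs_labelVal]) f hf
    refine h.trans ?_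
    gcongr
    rw [hB1, Nat.cast_one, mul_one, pow_zero]
    have e1 : Real.log 2 / (1 / √T) + 1 / √T * T / 2 = √T * (Real.log 2 + 1 / 2) := by
      nth_rw 3 [← hsT]; field_simp
    rw [e1]
    push_cast
    nlinarith
  | succ k ih =>
    intro B hBA hsep f hf
    obtain ⟨C, hCA, hCsep, hnet⟩ := exists_separated_net A ((1 / 4 : ℝ) ^ k * T)
    choose! π hπC hπ using hnet (by positivity)
    choose a haB hfa using hf
    have h1 := ih C hCA hCsep (fun σ => |radSum σ fun j => labelVal (π (a σ) j)|)
      fun σ => ⟨π (a σ), hπC _ (hBA (haB σ)), le_rfl⟩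
    have hB0 : 0 < (B.card : ℝ) := by exact_mod_cast Finset.card_pos.2 ⟨a 1, haB 1⟩
    have h2 := sum_le_of_le_radSum B (fun b j => labelVal (b j) - labelVal (π b j))
      (s := 4 * ((1 / 4 : ℝ) ^ k * T)) (l := 2 ^ (k + 1) * (√d / √T)) (by positivity)
      (fun b hb => by
        rw [sum_sq_sub_labelVal]; have := hπ b (hBA hb); linarith)
      (fun σ => |radSum σ fun j => labelVal (a σ j) - labelVal (π (a σ) j)|)
      fun σ => ⟨a σ, haB σ, le_rfl⟩
    have h3 : ∑ σ, f σ ≤ ∑ σ, |radSum σ fun j => labelVal (π (a σ) j)|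
        + ∑ σ, |radSum σ fun j => labelVal (a σ j) - labelVal (π (a σ) j)| := by
      rw [← Finset.sum_add_distrib]
      refine Finset.sum_le_sum fun σ _ => (hfa σ).trans ?_
      have : (radSum σ fun j => labelVal (a σ j)) = (radSum σ fun j => labelVal (π (a σ) j))
          + radSum σ fun j => labelVal (a σ j) - labelVal (π (a σ) j) := by
        simp only [radSum, ← Finset.sum_add_distrib]
        exact Finset.sum_congr rfl fun j _ => by ring
      rw [this]
      exact abs_add_le _ _
    have h4 : Real.log (2 * B.card) ≤ d * (2.8 * (k + 1) + 5.5) := by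
      have h5 := log_card_le_of_separated hd B
        (fun m hm q => (Nat.cast_le.2 (Finset.card_le_card
          (Finset.image_subset_image hBA))).trans (hA m hm q))
        (ε := (1 / 4 : ℝ) ^ (k + 1)) (by positivity)
        (pow_le_one₀ (by norm_num) (by norm_num)) hsep
      have h6 : Real.log (4 * Real.exp 1 / (1 / 4 : ℝ) ^ (k + 1))
          = 2 * (k + 2) * Real.log 2 + 1 := by
        rw [one_div, inv_pow, div_inv_eq_mul, mul_right_comm, ← pow_succ',
          Real.log_mul (by positivity) (by positivity), Real.log_exp, Real.log_pow,
          show (4 : ℝ) = 2 ^ 2 by norm_num, Real.log_pow]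
        push_cast; ring
      rw [h6] at h5
      rw [Real.log_mul (by norm_num) hB0.ne']
      have hk : (0 : ℝ) ≤ k := by positivity
      have hd2 : (1 : ℝ) ≤ d := by exact_mod_cast hd
      have h7 : 2 * (2 * (k + 2) * Real.log 2 + 1) ≤ 2.8 * ((k : ℝ) + 1) + 4.8 := by nlinarith
      nlinarith
    have h8 : Real.log (2 * B.card) / (2 ^ (k + 1) * (√d / √T))
        + 2 ^ (k + 1) * (√d / √T) * (4 * ((1 / 4 : ℝ) ^ k * T)) / 2
        ≤ √d * √T * ((1 / 2) ^ (k + 1) * (3 * (k + 1) + 14)) := by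
      have e1 : Real.log (2 * B.card) / (2 ^ (k + 1) * (√d / √T))
          ≤ √d * √T * ((1 / 2) ^ (k + 1) * (2.8 * (k + 1) + 5.5)) := by
        rw [div_le_iff₀ (by positivity)]
        refine h4.trans (le_of_eq ?_)
        nth_rw 1 [← hsd]
        rw [one_div, inv_pow]
        field_simp
      have e2 : 2 ^ (k + 1) * (√d / √T) * (4 * ((1 / 4 : ℝ) ^ k * T)) / 2
          = √d * √T * ((1 / 2) ^ (k + 1) * 8) := by
        nth_rw 2 [← hsT]
        rw [show (1 / 4 : ℝ) = 1 / 2 * (1 / 2) by norm_num, mul_pow, one_div, inv_pow, inv_pow]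
        field_simp
        ring
      rw [e2]
      refine (add_le_add_left e1 _).trans ?_
      rw [← mul_add, ← mul_add]
      have hk : (0 : ℝ) ≤ k := by positivity
      gcongr ?_ * (?_ * ?_)
      linarith
    calc ∑ σ, f σ ≤ 2 ^ T * (√d * √T * (22 - (1 / 2) ^ k * (3 * k + 20)))
          + 2 ^ T * (√d * √T * ((1 / 2) ^ (k + 1) * (3 * (k + 1) + 14))) :=
        h3.trans (add_le_add h1 (h2.trans (by gcongr)))
      _ = _ := by push_cast; ring

/-- The chaining bound for the Rademacher complexity of a class of VC dimension `d`, free of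
logarithmic factors. -/
lemma sum_le_of_growth {T d : ℕ} (hT : 1 ≤ T) (hd : 1 ≤ d) (A : Finset (Fin T → ℤˣ))
    (hA : ∀ m, d ≤ m → ∀ q : Fin m → Fin T,
      ((A.image fun u j => u (q j)).card : ℝ) ≤ (Real.exp 1 * m / d) ^ d)
    (f : (Fin T → ℤˣ) → ℝ) (hf : ∀ σ, ∃ a ∈ A, f σ ≤ |radSum σ fun j => labelVal (a j)|) :
    ∑ σ, f σ ≤ 2 ^ T * (22 * (√d * √T)) := by
  have h := sum_le_of_separated hT hd A hA T A subset_rfl (fun a _ b _ hab => ?_) f hf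
  · refine h.trans ?_
    rw [mul_comm (22 : ℝ)]
    gcongr ?_ * (?_ * ?_)
    have : (0 : ℝ) ≤ (1 / 2) ^ T * (3 * T + 20) := by positivity
    linarith
  · have h1 : (1 : ℝ) ≤ hammingDist a b := by
      exact_mod_cast Nat.one_le_iff_ne_zero.2 (hammingDist_ne_zero.2 hab)
    refine lt_of_lt_of_le ?_ h1
    rw [one_div, inv_pow, inv_mul_lt_iff₀ (by positivity), mul_one]
    exact_mod_cast Nat.lt_pow_self (by norm_num)

/-! ### Small uniform approximations -/

/-- Exchange the entries of the pair `(s, t)` of sequences at the indices with sign `-1`. -/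
def swapPair {Z : Type*} {N : ℕ} (σ : Fin N → ℤˣ) (x : (Fin N → Z) × (Fin N → Z)) :
    (Fin N → Z) × (Fin N → Z) :=
  (fun i => if σ i = 1 then x.1 i else x.2 i, fun i => if σ i = 1 then x.2 i else x.1 i)

lemma swapPair_swapPair {Z : Type*} {N : ℕ} (σ : Fin N → ℤˣ) (x : (Fin N → Z) × (Fin N → Z)) :
    swapPair σ (swapPair σ x) = x := by
  ext i <;> simp only [swapPair] <;> split_ifs <;> rfl

/-- `swapPair σ`, which is an involution, as a permutation. -/
def swapPairEquiv (Z : Type*) {N : ℕ} (σ : Fin N → ℤˣ) :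
    Equiv.Perm ((Fin N → Z) × (Fin N → Z)) :=
  ⟨swapPair σ, swapPair σ, swapPair_swapPair σ, swapPair_swapPair σ⟩

/-- A finite family of members of a class of VC dimension at most `d` has a uniform approximation
of size `T` with error less than `κ > 44 √(d / T)`: the averages over the `R` points `h r` are
simultaneously approximated by the averages over some `T` of these points. The expected error of
`T` random points is bounded by symmetrization and chaining. -/
lemma exists_uniform_approximation {A ι : Type*} [Finite ι] {C : Set (A → ℤˣ)} {T R d : ℕ}
    (hC : VCdim C ≤ d) (hd : 1 ≤ d) (hT : 1 ≤ T) (hR : 1 ≤ R) (h : Fin R → A)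
    (g : ι → A → ℤˣ) (hg : ∀ i, g i ∈ C) {κ : ℝ} (hκ : 44 * (√d * √T) < κ * T) :
    ∃ t : Fin T → Fin R, ∀ i,
      |∑ j, labelVal (g i (h (t j))) - T * ((∑ r, labelVal (g i (h r))) / R)| < κ * T := by
  classical
  have := Fintype.ofFinite ι
  have : NeZero R := ⟨by omega⟩
  have hR0 : (0 : ℝ) < R := by exact_mod_cast hR
  by_contra! hcon
  choose i hi using hcon
  have : Nonempty ι := ⟨i fun _ => 0⟩
  let a : ι → (Fin T → Fin R) → Fin T → ℝ := fun i t j => labelVal (g i (h (t j)))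
  let Ψ : (Fin T → Fin R) → (Fin T → ℤˣ) → ℝ := fun t σ => ⨆ i, |radSum σ (a i t)|
  let Φ : (Fin T → Fin R) × (Fin T → Fin R) → ℝ := fun x => ⨆ i, |∑ j, (a i x.1 j - a i x.2 j)|
  have hΨ : ∀ t, ∑ σ, Ψ t σ ≤ 2 ^ T * (22 * (√d * √T)) := by
    intro t
    refine sum_le_of_growth hT hd (traces C (h ∘ t)).toFinite.toFinset (fun m hm q => ?_) _
      fun σ => ?_
    · have h1 := ncard_traces_le_pow (C := C) hC hd (by simpa using hm) ((h ∘ t) ∘ q)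
      rw [traces_comp] at h1
      simp only [Fintype.card_fin] at h1
      refine le_trans (le_of_eq ?_) h1
      rw [Set.ncard_eq_toFinset_card', Nat.cast_inj]
      congr 1
      ext u
      simp
    · obtain ⟨i, hi⟩ := exists_eq_ciSup_of_finite (f := fun i => |radSum σ (a i t)|)
      exact ⟨fun j => g i (h (t j)), by simpa [traces] using ⟨g i, hg i, rfl⟩, hi.ge⟩
  -- the average over a second sample replaces the mean
  have hmean : ∀ i, ∑ t : Fin T → Fin R, ∑ j, a i t j
      = (R : ℝ) ^ T * (T * ((∑ r, labelVal (g i (h r))) / R)) := by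
    intro i
    rw [Finset.sum_comm]
    have h1 : ∀ j : Fin T, ∑ t : Fin T → Fin R, a i t j
        = (R : ℝ) ^ T * ((∑ r, labelVal (g i (h r))) / R) := by
      intro j
      have h2 := Fintype.sum_piFinset_apply (κ := Fin R) (fun r => labelVal (g i (h r)))
        Finset.univ j
      rw [Fintype.piFinset_univ] at h2
      simp only [a, h2, Finset.card_univ, Fintype.card_fin, nsmul_eq_mul]
      obtain ⟨k, rfl⟩ : ∃ k, T = k + 1 := ⟨T - 1, by omega⟩
      push_cast
      rw [pow_succ]
      field_simp
    simp only [h1, Finset.sum_const, Finset.card_univ, Fintype.card_fin, nsmul_eq_mul]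
    ring
  have hlow : (R : ℝ) ^ T * (R : ℝ) ^ T * (κ * T) ≤ ∑ x, Φ x := by
    have h1 : ∀ t, (R : ℝ) ^ T * (κ * T) ≤ ∑ t', Φ (t, t') := by
      intro t
      calc (R : ℝ) ^ T * (κ * T)
          ≤ (R : ℝ) ^ T * |∑ j, a (i t) t j - T * ((∑ r, labelVal (g (i t) (h r))) / R)| := by
            gcongr; exact hi t
        _ = |∑ t' : Fin T → Fin R, ∑ j, (a (i t) t j - a (i t) t' j)| := by
            have hpos : (0 : ℝ) < (R : ℝ) ^ T := by positivity
            nth_rw 1 [← abs_of_pos hpos]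
            rw [← abs_mul, mul_sub, ← hmean]
            simp [Finset.sum_sub_distrib]
        _ ≤ ∑ t' : Fin T → Fin R, |∑ j, (a (i t) t j - a (i t) t' j)| :=
            Finset.abs_sum_le_sum_abs _ _
        _ ≤ ∑ t', Φ (t, t') := Finset.sum_le_sum fun t' _ =>
            le_ciSup (f := fun i => |∑ j, (a i t j - a i t' j)|)
              (Set.finite_range _).bddAbove (i t)
    calc (R : ℝ) ^ T * (R : ℝ) ^ T * (κ * T) = ∑ t : Fin T → Fin R, (R : ℝ) ^ T * (κ * T) := by
          simp; ring
      _ ≤ ∑ t, ∑ t', Φ (t, t') := Finset.sum_le_sum fun t _ => h1 t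
      _ = ∑ x, Φ x := (Fintype.sum_prod_type _).symm
  have hswap : ∀ (x : (Fin T → Fin R) × (Fin T → Fin R)) (σ : Fin T → ℤˣ),
      Φ (swapPair σ x) ≤ Ψ x.1 σ + Ψ x.2 σ := by
    intro x σ
    refine ciSup_le fun i => ?_
    have h1 : ∑ j, (a i (swapPair σ x).1 j - a i (swapPair σ x).2 j)
        = radSum σ (a i x.1) - radSum σ (a i x.2) := by
      rw [radSum, radSum, ← Finset.sum_sub_distrib]
      refine Finset.sum_congr rfl fun j _ => ?_
      rcases Int.units_eq_one_or (σ j) with h1 | h1 <;>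
        simp [a, swapPair, h1, labelVal_one, labelVal_neg_one, add_comm, sub_eq_add_neg]
    rw [h1]
    refine (abs_sub _ _).trans (add_le_add ?_ ?_)
    · exact le_ciSup (f := fun i => |radSum σ (a i x.1)|) (Set.finite_range _).bddAbove i
    · exact le_ciSup (f := fun i => |radSum σ (a i x.2)|) (Set.finite_range _).bddAbove i
  have hup : 2 ^ T * ∑ x, Φ x
      ≤ (R : ℝ) ^ T * (R : ℝ) ^ T * (2 * (2 ^ T * (22 * (√d * √T)))) := by
    calc 2 ^ T * ∑ x, Φ x = ∑ σ : Fin T → ℤˣ, ∑ x, Φ x := by simp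
      _ = ∑ σ : Fin T → ℤˣ, ∑ x, Φ (swapPair σ x) :=
          Finset.sum_congr rfl fun σ _ => (Equiv.sum_comp (swapPairEquiv _ σ) Φ).symm
      _ = ∑ x, ∑ σ : Fin T → ℤˣ, Φ (swapPair σ x) := Finset.sum_comm
      _ ≤ ∑ x : (Fin T → Fin R) × (Fin T → Fin R), (2 * (2 ^ T * (22 * (√d * √T)))) := by
          refine Finset.sum_le_sum fun x _ => ?_
          refine (Finset.sum_le_sum fun σ _ => hswap x σ).trans ?_
          rw [Finset.sum_add_distrib]
          linarith [hΨ x.1, hΨ x.2]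
      _ = _ := by simp
  have h2 : (0 : ℝ) < 2 ^ T * ((R : ℝ) ^ T * (R : ℝ) ^ T) := by positivity
  have h3 : 2 ^ T * ((R : ℝ) ^ T * (R : ℝ) ^ T) * (κ * T)
      ≤ 2 ^ T * ((R : ℝ) ^ T * (R : ℝ) ^ T) * (44 * (√d * √T)) := by
    calc _ = 2 ^ T * ((R : ℝ) ^ T * (R : ℝ) ^ T * (κ * T)) := by ring
      _ ≤ 2 ^ T * ∑ x, Φ x := by gcongr
      _ ≤ _ := hup
      _ = _ := by ring
  exact absurd (le_of_mul_le_mul_left h3 h2) (not_le.2 hκ)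

/-! ### A relative deviation inequality for classes with few traces -/

instance : MeasurableSingletonClass ℤˣ :=
  ⟨fun y => ⟨{(y : ℤ)}, measurableSet_singleton _, by ext z; simp [Units.ext_iff]⟩⟩

/-- The indicator of the label `-1`. -/
def negInd (y : ℤˣ) : ℝ := if y = -1 then 1 else 0

lemma negInd_one : negInd 1 = 0 := by simp [negInd, units_ne_neg_self]

lemma negInd_neg_one : negInd (-1) = 1 := by simp [negInd]

lemma negInd_nonneg (y : ℤˣ) : 0 ≤ negInd y := by unfold negInd; split_ifs <;> norm_num

lemma negInd_le_one (y : ℤˣ) : negInd y ≤ 1 := by unfold negInd; split_ifs <;> norm_num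

/-- `swapPair σ` preserves the law of two independent samples. -/
lemma measurePreserving_swapPair {Z : Type*} [Countable Z] [MeasurableSpace Z]
    [MeasurableSingletonClass Z] (D : Measure Z) [IsProbabilityMeasure D] {N : ℕ}
    (σ : Fin N → ℤˣ) :
    MeasurePreserving (swapPair (Z := Z) σ)
      ((Measure.pi fun _ : Fin N => D).prod (Measure.pi fun _ : Fin N => D))
      ((Measure.pi fun _ : Fin N => D).prod (Measure.pi fun _ : Fin N => D)) := by
  have hm : Measurable (swapPair (Z := Z) σ) := .of_discrete
  refine ⟨hm, Measure.ext_of_singleton fun x => ?_⟩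
  rw [Measure.map_apply hm (measurableSet_singleton _)]
  have h1 : swapPair σ ⁻¹' {x} = {swapPair σ x} := by
    ext y
    simp only [Set.mem_preimage, Set.mem_singleton_iff]
    exact ⟨fun h => by rw [← h, swapPair_swapPair], fun h => by rw [h, swapPair_swapPair]⟩
  have h2 : ∀ y : (Fin N → Z) × (Fin N → Z),
      ((Measure.pi fun _ : Fin N => D).prod (Measure.pi fun _ : Fin N => D)) {y}
        = ∏ i, D {y.1 i} * D {y.2 i} := by
    intro y
    rw [← Set.singleton_prod_singleton, Measure.prod_prod, Measure.pi_singleton,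
      Measure.pi_singleton, Finset.prod_mul_distrib]
  rw [h1, h2, h2]
  refine Finset.prod_congr rfl fun i _ => ?_
  simp only [swapPair]
  split_ifs
  · rfl
  · exact mul_comm _ _

/-- `exp` of the `(α, β)`-weighted numbers of labels `-1` in the two halves of `p`. -/
def pairWeight {N : ℕ} (α β : ℝ) (p : Fin N ⊕ Fin N → ℤˣ) : ℝ :=
  Real.exp (∑ i, (α * negInd (p (.inl i)) + β * negInd (p (.inr i))))

/-- `swapPair σ` for labellings of the disjoint union of two copies of the index set. -/
def swapSum {Z : Type*} {N : ℕ} (σ : Fin N → ℤˣ) (p : Fin N ⊕ Fin N → Z) : Fin N ⊕ Fin N → Z :=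
  Sum.elim (fun i => if σ i = 1 then p (.inl i) else p (.inr i))
    (fun i => if σ i = 1 then p (.inr i) else p (.inl i))

lemma traces_swapPair {Z : Type*} {N : ℕ} (C : Set (Z → ℤˣ)) (σ : Fin N → ℤˣ)
    (x : (Fin N → Z) × (Fin N → Z)) :
    traces C (Sum.elim (swapPair σ x).1 (swapPair σ x).2)
      = swapSum σ '' traces C (Sum.elim x.1 x.2) := by
  simp only [traces, Set.image_image]
  refine Set.image_congr fun g _ => ?_
  funext i
  rcases i with i | i <;> simp only [swapPair, swapSum, Sum.elim_inl, Sum.elim_inr] <;>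
    split_ifs <;> rfl

/-- Random swaps average the weight to at most `1`, since a pair of different labels contributes
the factor `(e ^ α + e ^ β) / 2` and a pair of labels `-1` the factor `e ^ (α + β)`. -/
lemma sum_pairWeight_swapSum_le {N : ℕ} {α β : ℝ} (h : Real.exp α + Real.exp β ≤ 2)
    (p : Fin N ⊕ Fin N → ℤˣ) :
    ∑ σ : Fin N → ℤˣ, pairWeight α β (swapSum σ p) ≤ 2 ^ N := by
  have h0 : Real.exp (α + β) ≤ 1 := by
    rw [Real.exp_add]
    nlinarith [Real.exp_pos α, Real.exp_pos β, sq_nonneg (Real.exp α - Real.exp β)]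
  let F : Fin N → ℤˣ → ℝ := fun i y => Real.exp
    (α * negInd (if y = 1 then p (.inl i) else p (.inr i))
      + β * negInd (if y = 1 then p (.inr i) else p (.inl i)))
  calc ∑ σ : Fin N → ℤˣ, pairWeight α β (swapSum σ p) = ∑ σ : Fin N → ℤˣ, ∏ i, F i (σ i) := by
        refine Finset.sum_congr rfl fun σ _ => ?_
        rw [pairWeight, Real.exp_sum]
        rfl
    _ = ∏ i, ∑ y, F i y := by rw [Finset.prod_univ_sum, Fintype.piFinset_univ]
    _ ≤ ∏ _i : Fin N, (2 : ℝ) := by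
        refine Finset.prod_le_prod (fun _ _ => Finset.sum_nonneg fun _ _ => (Real.exp_pos _).le)
          fun i _ => ?_
        rw [sum_units]
        have hne : (-1 : ℤˣ) ≠ 1 := by decide
        simp only [F, if_true, if_neg hne]
        rcases Int.units_eq_one_or (p (.inl i)) with h1 | h1 <;>
          rcases Int.units_eq_one_or (p (.inr i)) with h2 | h2 <;>
          simp only [h1, h2, negInd_one, negInd_neg_one, mul_zero, mul_one, add_zero, zero_add,
            Real.exp_zero] <;> linarith
    _ = 2 ^ N := by simp

/-- Jensen's inequality turns the probability of `{ℓ = -1}` into its frequency in a second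
sample. -/
lemma ofReal_exp_le_lintegral_pairWeight {Z : Type*} [Countable Z] [MeasurableSpace Z]
    [MeasurableSingletonClass Z] (D : Measure Z) [IsProbabilityMeasure D] {N : ℕ}
    (l : Z → ℤˣ) (α β : ℝ) (S : Fin N → Z) :
    ENNReal.ofReal (Real.exp (α * ∑ i, negInd (l (S i)) + β * (N * D.real {z | l z = -1})))
      ≤ ∫⁻ S', ENNReal.ofReal (pairWeight α β fun i => l (Sum.elim S S' i))
          ∂Measure.pi fun _ : Fin N => D := by
  set μ := Measure.pi fun _ : Fin N => D
  have hint1 : Integrable (fun z => negInd (l z)) D :=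
    Integrable.of_bound (Measurable.of_discrete).aestronglyMeasurable 1
      (.of_forall fun z => by rw [Real.norm_of_nonneg (negInd_nonneg _)]; exact negInd_le_one _)
  have hint2 : ∀ i : Fin N, Integrable (fun S' : Fin N → Z => negInd (l (S' i))) μ := fun i =>
    (measurePreserving_eval (fun _ : Fin N => D) i).integrable_comp_of_integrable hint1
  have hmean : ∀ i : Fin N, ∫ S', negInd (l (S' i)) ∂μ = D.real {z | l z = -1} := by
    intro i
    have h1 : ∫ S', negInd (l (S' i)) ∂μ = ∫ z, negInd (l z) ∂D := by
      rw [← (measurePreserving_eval (fun _ : Fin N => D) i).map_eq,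
        integral_map (measurable_pi_apply i).aemeasurable
          (Measurable.of_discrete).aestronglyMeasurable]
    rw [h1]
    have h2 : (fun z => negInd (l z)) = Set.indicator {z | l z = -1} 1 := by
      funext z; simp [negInd, Set.indicator]
    rw [h2, integral_indicator_one .of_discrete]
  let Y : (Fin N → Z) → ℝ := fun S' =>
    ∑ i, (α * negInd (l (S i)) + β * negInd (l (S' i)))
  have hY : Integrable Y μ := integrable_finsetSum _ fun i _ =>
    (integrable_const _).add ((hint2 i).const_mul β)
  have hYmean : ∫ S', Y S' ∂μ = α * ∑ i, negInd (l (S i)) + β * (N * D.real {z | l z = -1}) := by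
    simp only [Y]
    rw [integral_finsetSum (μ := μ)
      (f := fun (i : Fin N) (S' : Fin N → Z) => α * negInd (l (S i)) + β * negInd (l (S' i))) _
      fun i _ => (integrable_const _).add ((hint2 i).const_mul β)]
    have : ∀ i : Fin N, ∫ S', (α * negInd (l (S i)) + β * negInd (l (S' i))) ∂μ
        = α * negInd (l (S i)) + β * D.real {z | l z = -1} := by
      intro i
      rw [integral_add (integrable_const _) ((hint2 i).const_mul β), integral_const_mul β, hmean]
      simp
    simp only [this, Finset.sum_add_distrib, ← Finset.mul_sum]
    simp
  have hYb : ∀ S', Y S' ≤ N * (|α| + |β|) := by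
    intro S'
    have : ∀ i : Fin N, α * negInd (l (S i)) + β * negInd (l (S' i)) ≤ |α| + |β| := by
      intro i
      have h1 : ∀ (a : ℝ) (y : ℤˣ), a * negInd y ≤ |a| := fun a y =>
        (mul_le_mul_of_nonneg_right (le_abs_self a) (negInd_nonneg y)).trans
          (mul_le_of_le_one_right (abs_nonneg a) (negInd_le_one y))
      exact add_le_add (h1 _ _) (h1 _ _)
    calc Y S' ≤ ∑ _i : Fin N, (|α| + |β|) := Finset.sum_le_sum fun i _ => this i
      _ = _ := by simp [mul_add]
  have hE : Integrable (fun S' => Real.exp (Y S')) μ :=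
    Integrable.of_bound (Measurable.of_discrete).aestronglyMeasurable
      (Real.exp (N * (|α| + |β|))) (.of_forall fun S' => by
        rw [Real.norm_of_nonneg (Real.exp_pos _).le]; exact Real.exp_le_exp.2 (hYb S'))
  have hJ := convexOn_exp.map_integral_le Real.continuous_exp.continuousOn isClosed_univ
    (.of_forall fun _ => Set.mem_univ _) hY hE
  rw [hYmean] at hJ
  refine (ENNReal.ofReal_le_ofReal hJ).trans (le_of_eq ?_)
  rw [ofReal_integral_eq_lintegral_ofReal hE (.of_forall fun _ => (Real.exp_pos _).le)]
  rfl

/-- The deviation inequality: if the class `C` has at most `Γ` traces on two samples, then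
uniformly over `C` a weighted sum of the empirical frequency and the probability of the label `-1`
is exponentially unlikely to be large. One of the weights is negative. -/
theorem measure_exists_deviation_le {Z : Type*} [Countable Z] [MeasurableSpace Z]
    [MeasurableSingletonClass Z] (D : Measure Z) [IsProbabilityMeasure D] {N : ℕ}
    (C : Set (Z → ℤˣ)) {Γ : ℝ}
    (hΓ : ∀ p : Fin N ⊕ Fin N → Z, ((traces C p).ncard : ℝ) ≤ Γ)
    {α β : ℝ} (h : Real.exp α + Real.exp β ≤ 2) (t : ℝ) :
    (Measure.pi fun _ : Fin N => D) {S | ∃ l ∈ C,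
        t ≤ α * ∑ i, negInd (l (S i)) + β * (N * D.real {z | l z = -1})}
      ≤ ENNReal.ofReal (Γ * Real.exp (-t)) := by
  classical
  set μ := Measure.pi fun _ : Fin N => D
  set Bad := {S : Fin N → Z | ∃ l ∈ C,
        t ≤ α * ∑ i, negInd (l (S i)) + β * (N * D.real {z | l z = -1})}
  let 𝒯 : (Fin N → Z) × (Fin N → Z) → Finset (Fin N ⊕ Fin N → ℤˣ) := fun x =>
    (traces C (Sum.elim x.1 x.2)).toFinite.toFinset
  let G : (Fin N → Z) × (Fin N → Z) → ENNReal := fun x =>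
    ∑ p ∈ 𝒯 x, ENNReal.ofReal (pairWeight α β p)
  have hcard : ∀ x, ((𝒯 x).card : ℝ) ≤ Γ := fun x => by
    rw [← Set.ncard_eq_toFinset_card]; exact hΓ _
  -- the bad event is paid for by the second sample
  have h1 : ∀ S ∈ Bad, ENNReal.ofReal (Real.exp t) ≤ ∫⁻ S', G (S, S') ∂μ := by
    rintro S ⟨l, hl, hS⟩
    refine (ENNReal.ofReal_le_ofReal (Real.exp_le_exp.2 hS)).trans
      ((ofReal_exp_le_lintegral_pairWeight D l α β S).trans (lintegral_mono fun S' => ?_))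
    refine Finset.single_le_sum (f := fun p => ENNReal.ofReal (pairWeight α β p))
      (fun _ _ => zero_le) ?_
    simp only [𝒯, Set.Finite.mem_toFinset]
    exact ⟨l, hl, rfl⟩
  have h2 : ENNReal.ofReal (Real.exp t) * μ Bad ≤ ∫⁻ x, G x ∂(μ.prod μ) := by
    rw [lintegral_prod _ (Measurable.of_discrete).aemeasurable]
    have hB : MeasurableSet Bad := .of_discrete
    rw [← setLIntegral_const]
    refine (setLIntegral_mono' hB h1).trans (setLIntegral_le_lintegral _ _)
  -- symmetrization
  have h3 : 2 ^ N * ∫⁻ x, G x ∂(μ.prod μ) ≤ ENNReal.ofReal (2 ^ N * Γ) := by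
    have h4 : ∀ σ : Fin N → ℤˣ, ∫⁻ x, G x ∂(μ.prod μ) = ∫⁻ x, G (swapPair σ x) ∂(μ.prod μ) :=
      fun σ => ((measurePreserving_swapPair D σ).lintegral_comp .of_discrete).symm
    calc 2 ^ N * ∫⁻ x, G x ∂(μ.prod μ)
        = ∑ σ : Fin N → ℤˣ, ∫⁻ x, G (swapPair σ x) ∂(μ.prod μ) := by
          rw [← Finset.sum_congr rfl fun σ _ => h4 σ]
          simp
      _ = ∫⁻ x, ∑ σ : Fin N → ℤˣ, G (swapPair σ x) ∂(μ.prod μ) :=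
          (lintegral_finsetSum _ fun _ _ => .of_discrete).symm
      _ ≤ ∫⁻ x, ENNReal.ofReal (2 ^ N * Γ) ∂(μ.prod μ) := by
          refine lintegral_mono fun x => ?_
          have h5 : ∀ σ : Fin N → ℤˣ, G (swapPair σ x)
              ≤ ∑ p ∈ 𝒯 x, ENNReal.ofReal (pairWeight α β (swapSum σ p)) := by
            intro σ
            have h6 : 𝒯 (swapPair σ x) = (𝒯 x).image (swapSum σ) := by
              ext p
              simp only [𝒯, Set.Finite.mem_toFinset, traces_swapPair, Set.mem_image,
                Finset.mem_image]
            simp only [G, h6]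
            exact Finset.sum_image_le_of_nonneg fun _ _ => zero_le
          calc ∑ σ : Fin N → ℤˣ, G (swapPair σ x)
              ≤ ∑ σ : Fin N → ℤˣ, ∑ p ∈ 𝒯 x, ENNReal.ofReal (pairWeight α β (swapSum σ p)) :=
                Finset.sum_le_sum fun σ _ => h5 σ
            _ = ∑ p ∈ 𝒯 x, ENNReal.ofReal (∑ σ : Fin N → ℤˣ, pairWeight α β (swapSum σ p)) := by
                rw [Finset.sum_comm]
                exact Finset.sum_congr rfl fun p _ =>
                  (ENNReal.ofReal_sum_of_nonneg fun _ _ => (Real.exp_pos _).le).symm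
            _ ≤ ∑ p ∈ 𝒯 x, ENNReal.ofReal (2 ^ N) := Finset.sum_le_sum fun p _ =>
                ENNReal.ofReal_le_ofReal (sum_pairWeight_swapSum_le h p)
            _ = ENNReal.ofReal (2 ^ N * (𝒯 x).card) := by
                rw [Finset.sum_const, nsmul_eq_mul, mul_comm, ENNReal.ofReal_mul (by positivity),
                  ENNReal.ofReal_natCast]
            _ ≤ ENNReal.ofReal (2 ^ N * Γ) := by gcongr; exact hcard x
      _ = ENNReal.ofReal (2 ^ N * Γ) := by simp
  have h7 : ENNReal.ofReal (2 ^ N * Real.exp t) * μ Bad ≤ ENNReal.ofReal (2 ^ N * Γ) := by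
    rw [ENNReal.ofReal_mul (by positivity), mul_assoc, ENNReal.ofReal_pow (by norm_num),
      ENNReal.ofReal_ofNat]
    exact (mul_le_mul_right h2 _).trans h3
  have h8 : (0 : ℝ) < 2 ^ N * Real.exp t := by positivity
  calc μ Bad ≤ ENNReal.ofReal (2 ^ N * Γ) / ENNReal.ofReal (2 ^ N * Real.exp t) := by
        rw [ENNReal.le_div_iff_mul_le (.inl (ENNReal.ofReal_pos.2 h8).ne')
          (.inl ENNReal.ofReal_ne_top), mul_comm]
        exact h7
    _ = ENNReal.ofReal (Γ * Real.exp (-t)) := by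
        rw [← ENNReal.ofReal_div_of_pos h8, Real.exp_neg]
        congr 1
        field_simp

/-! ### Boosting -/

/-- One step of multiplicative weights: an edge of at least `2 θ` shrinks the exponential potential
by a factor that beats `exp (-θ ^ 2)`, which leaves a positive margin after `ln n / θ ^ 2` steps. -/
lemma sum_mul_exp_le_of_edge {ι : Type*} (G : Finset ι) (w : ι → ℝ) (hw : ∀ i ∈ G, 0 < w i)
    (v : ι → ℤˣ) {θ : ℝ} (hθ : 0 < θ) (hθ1 : θ ≤ 1 / 2)
    (hedge : 2 * θ * ∑ i ∈ G, w i ≤ ∑ i ∈ G, w i * labelVal (v i)) :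
    ∑ i ∈ G, w i * Real.exp (-θ * labelVal (v i))
      ≤ Real.exp (-(23 / 16) * θ ^ 2) * ∑ i ∈ G, w i := by
  have h1 : ∀ i ∈ G, w i * Real.exp (-θ * labelVal (v i))
      = Real.cosh θ * w i - Real.sinh θ * (w i * labelVal (v i)) := by
    intro i _
    rw [Real.cosh_eq, Real.sinh_eq]
    rcases Int.units_eq_one_or (v i) with h | h <;>
      simp only [h, labelVal_one, labelVal_neg_one, mul_one, mul_neg, neg_neg] <;> ring
  have hW : 0 ≤ ∑ i ∈ G, w i := Finset.sum_nonneg fun i hi => (hw i hi).le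
  have hsinh : θ ≤ Real.sinh θ := Real.self_le_sinh_iff.2 hθ.le
  -- the exponent is `9 / 16 - 2`: the growth of `cosh` minus the edge times `sinh θ ≥ θ`
  have hcosh : Real.cosh θ ≤ 1 + 9 / 16 * θ ^ 2 := by
    refine (Real.cosh_le_exp_half_sq θ).trans ?_
    have h2 := Real.abs_exp_sub_one_sub_id_le (x := θ ^ 2 / 2)
      (by rw [abs_of_nonneg (by positivity)]; nlinarith)
    have h3 := (abs_le.1 h2).2
    have h4 : θ ^ 2 ≤ 1 / 4 := by nlinarith
    have h5 := mul_le_mul_of_nonneg_right h4 (sq_nonneg θ)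
    nlinarith
  rw [Finset.sum_congr rfl h1, Finset.sum_sub_distrib, ← Finset.mul_sum, ← Finset.mul_sum]
  have h4 : Real.sinh θ * (2 * θ * ∑ i ∈ G, w i)
      ≤ Real.sinh θ * ∑ i ∈ G, w i * labelVal (v i) := by gcongr
  have h5 : 1 + -(23 / 16) * θ ^ 2 ≤ Real.exp (-(23 / 16) * θ ^ 2) := by
    have := Real.add_one_le_exp (-(23 / 16) * θ ^ 2); linarith
  have h6 : Real.cosh θ - Real.sinh θ * (2 * θ) ≤ 1 + -(23 / 16) * θ ^ 2 := by nlinarith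
  nlinarith [mul_le_mul_of_nonneg_right (h6.trans h5) hW]

/-- Adaptive boosting against independent rounds. In every round a finite family `o` of labellings
is drawn from `P`; if for all weights it contains, up to probability `p`, a labelling that shrinks
the potential by the factor `q`, then `R` rounds achieve the factor `q ^ R` up to probability
`R * p`. -/
lemma measure_not_exists_boosted_le {ι J : Type*} [Finite ι] [Finite J]
    (P : Measure (J → ι → ℤˣ)) [IsProbabilityMeasure P] (G : Finset ι) (θ q : ℝ) (hq : 0 ≤ q)
    (p : ENNReal)
    (hgood : ∀ w : ι → ℝ, (∀ i ∈ G, 0 < w i) → P {o | ¬∃ j,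
      ∑ i ∈ G, w i * Real.exp (-θ * labelVal (o j i)) ≤ q * ∑ i ∈ G, w i} ≤ p) (R : ℕ) :
    ∀ w : ι → ℝ, (∀ i ∈ G, 0 < w i) → (Measure.pi fun _ : Fin R => P) {ω | ¬∃ j : Fin R → J,
      ∑ i ∈ G, w i * Real.exp (-θ * ∑ r, labelVal (ω r (j r) i)) ≤ q ^ R * ∑ i ∈ G, w i}
      ≤ R * p := by
  classical
  have : Fintype ι := Fintype.ofFinite ι
  have : Fintype J := Fintype.ofFinite J
  induction R with
  | zero => intro w _; simp
  | succ R ih =>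
    intro w hw
    let π := Measure.pi fun _ : Fin R => P
    let good : (ι → ℤˣ) → Prop := fun v =>
      ∑ i ∈ G, w i * Real.exp (-θ * labelVal (v i)) ≤ q * ∑ i ∈ G, w i
    let next : (ι → ℤˣ) → ι → ℝ := fun v i => w i * Real.exp (-θ * labelVal (v i))
    let Fail : (ι → ℝ) → Set (Fin R → J → ι → ℤˣ) := fun w => {ω | ¬∃ j : Fin R → J,
      ∑ i ∈ G, w i * Real.exp (-θ * ∑ r, labelVal (ω r (j r) i)) ≤ q ^ R * ∑ i ∈ G, w i}
    let E : Set ((J → ι → ℤˣ) × (Fin R → J → ι → ℤˣ)) :=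
      {x | ∀ j, good (x.1 j) → x.2 ∈ Fail (next (x.1 j))}
    -- a good first choice `j₀` reweights the examples, and the later rounds start from `next`
    have hsub : {ω : Fin (R + 1) → J → ι → ℤˣ | ¬∃ j : Fin (R + 1) → J,
        ∑ i ∈ G, w i * Real.exp (-θ * ∑ r, labelVal (ω r (j r) i))
          ≤ q ^ (R + 1) * ∑ i ∈ G, w i}
        ⊆ MeasurableEquiv.piFinSuccAbove (fun _ : Fin (R + 1) => J → ι → ℤˣ) 0 ⁻¹' E := by
      rintro ω hω j₀ hj₀ ⟨j, hj⟩
      refine hω ⟨Fin.cons j₀ j, ?_⟩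
      calc ∑ i ∈ G, w i * Real.exp (-θ * ∑ r, labelVal (ω r (Fin.cons (α := fun _ => J) j₀ j r) i))
          = ∑ i ∈ G, next (ω 0 j₀) i
              * Real.exp (-θ * ∑ r : Fin R, labelVal (ω r.succ (j r) i)) := by
            refine Finset.sum_congr rfl fun i _ => ?_
            rw [Fin.sum_univ_succ, mul_add, Real.exp_add, ← mul_assoc]
            rfl
        _ ≤ q ^ R * ∑ i ∈ G, next (ω 0 j₀) i := hj
        _ ≤ q ^ R * (q * ∑ i ∈ G, w i) := by gcongr; exact hj₀
        _ = q ^ (R + 1) * ∑ i ∈ G, w i := by rw [pow_succ]; ring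
    have hE : MeasurableSet E := E.to_countable.measurableSet
    refine (measure_mono hsub).trans ?_
    rw [(measurePreserving_piFinSuccAbove (fun _ : Fin (R + 1) => P) 0).measure_preimage_equiv,
      Measure.prod_apply hE]
    have hsec : ∀ o : J → ι → ℤˣ, π (Prod.mk o ⁻¹' E)
        ≤ {o | ¬∃ j, good (o j)}.indicator 1 o + R * p := by
      intro o
      by_cases ho : ∃ j, good (o j)
      · obtain ⟨j, hj⟩ := ho
        have h1 : Prod.mk o ⁻¹' E ⊆ Fail (next (o j)) := fun τ hτ => hτ j hj
        exact (measure_mono h1).trans ((ih _ fun i hi => mul_pos (hw i hi) (Real.exp_pos _)).trans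
          le_add_self)
      · rw [Set.indicator_of_mem (by exact ho)]
        exact prob_le_one.trans le_self_add
    calc ∫⁻ o, π (Prod.mk o ⁻¹' E) ∂P
        ≤ ∫⁻ o, ({o | ¬∃ j, good (o j)}.indicator 1 o + R * p) ∂P := lintegral_mono hsec
      _ = P {o | ¬∃ j, good (o j)} + R * p := by
          rw [lintegral_add_right _ measurable_const, lintegral_indicator_one .of_discrete]
          simp
      _ ≤ p + R * p := by gcongr; exact hgood w hw
      _ = (R + 1 : ℕ) * p := by push_cast; ring

/-- Some subsample makes the weak learner succeed for a weighting of correctly labelled examples: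
its guarantee is applied to the weighted empirical distribution, where the correlation of `f` is
`1`. -/
lemma exists_subsample_of_isAgnosticWeakLearner {X B : Type*} [Countable X] [MeasurableSpace X]
    [MeasurableSingletonClass X] [MeasurableSpace B] {U : Measure B} [IsProbabilityMeasure U]
    {F H : Set (X → ℤˣ)} {γ₀ ε₀ δ₀ : ℝ} {m₀ : ℕ} {W : Learner X B}
    (hW : IsAgnosticWeakLearner F H γ₀ ε₀ δ₀ m₀ U W) (hγ : 0 ≤ γ₀) {N : ℕ}
    (S : Fin N → X × ℤˣ)
    {f : X → ℤˣ} (hf : f ∈ F) (G : Finset (Fin N)) (hG : G.Nonempty)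
    (hfG : ∀ i ∈ G, f (S i).1 = (S i).2) (w : Fin N → ℝ) (hw : ∀ i ∈ G, 0 < w i) :
    ∃ I : Fin m₀ → Fin N, U {b | ¬(γ₀ - ε₀) * ∑ i ∈ G, w i
      ≤ ∑ i ∈ G, w i * labelVal (W m₀ (fun j => S (I j)) b (S i).1 * (S i).2)}
      ≤ ENNReal.ofReal δ₀ := by
  classical
  set w₁ := ∑ i ∈ G, w i with hw₁
  have hw₁0 : 0 < w₁ := Finset.sum_pos hw hG
  set ρ : Measure (X × ℤˣ) := ∑ i ∈ G, ENNReal.ofReal (w i / w₁) • Measure.dirac (S i) with hρ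
  have hρapply : ∀ E : Set (X × ℤˣ),
      ρ E = ∑ i ∈ G, ENNReal.ofReal (w i / w₁) * E.indicator 1 (S i) := by
    intro E
    simp [hρ, Measure.finsetSum_apply]
  have hρprob : IsProbabilityMeasure ρ := by
    refine ⟨?_⟩
    rw [hρapply]
    simp only [Set.indicator_univ, Pi.one_apply, mul_one]
    rw [← ENNReal.ofReal_sum_of_nonneg fun i hi => (div_pos (hw i hi) hw₁0).le, ← Finset.sum_div,
      ← hw₁, div_self hw₁0.ne', ENNReal.ofReal_one]
  have hcorr : ∀ h : X → ℤˣ, corr ρ h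
      = (∑ i ∈ G, w i * labelVal (h (S i).1 * (S i).2)) / w₁ := by
    intro h
    have hint : ∀ i ∈ G, Integrable (fun z : X × ℤˣ => labelVal (h z.1) * labelVal z.2)
        (ENNReal.ofReal (w i / w₁) • Measure.dirac (S i)) := fun i _ =>
      (integrable_dirac enorm_lt_top).smul_measure ENNReal.ofReal_ne_top
    rw [corr, hρ, integral_finsetSum_measure hint, Finset.sum_div]
    refine Finset.sum_congr rfl fun i hi => ?_
    rw [integral_smul_measure, integral_dirac, ENNReal.toReal_ofReal (div_pos (hw i hi) hw₁0).le]
    simp only [labelVal, Units.val_mul, Int.cast_mul, smul_eq_mul]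
    ring
  have hfcorr : corr ρ f = 1 := by
    rw [hcorr, div_eq_one_iff_eq hw₁0.ne', hw₁]
    refine Finset.sum_congr rfl fun i hi => ?_
    rw [hfG i hi, Int.units_mul_self, labelVal_one, mul_one]
  have hsup : 1 ≤ ⨆ f : F, corr ρ f := by
    rw [← hfcorr]
    refine le_ciSup (f := fun f : F => corr ρ f) ⟨1, ?_⟩ ⟨f, hf⟩
    rintro _ ⟨g, rfl⟩
    simp only [hcorr]
    rw [div_le_one hw₁0, hw₁]
    refine Finset.sum_le_sum fun i hi => mul_le_of_le_one_right (hw i hi).le ?_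
    exact (le_abs_self _).trans (abs_labelVal _).le
  set π := Measure.pi fun _ : Fin m₀ => ρ
  let A : Set ((Fin m₀ → X × ℤˣ) × B) := {x | γ₀ - ε₀ ≤ corr ρ (W m₀ x.1 x.2)}
  have hmeas : ∀ S', Measurable fun b => corr ρ (W m₀ S' b) := by
    intro S'
    simp only [hcorr]
    refine Measurable.div_const (Finset.measurable_sum _ fun i _ => Measurable.const_mul ?_ _) _
    exact (Measurable.of_discrete (f := fun y : ℤˣ => labelVal (y * (S i).2))).comp
      (hW.measurable_seed m₀ S' (S i).1)
  have hAmeas : MeasurableSet A := measurableSet_le measurable_const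
    (measurable_from_prod_countable_right hmeas)
  have hA : ENNReal.ofReal (1 - δ₀) ≤ (π.prod U) A := by
    have h1 := hW.guarantee ρ hρprob
    have h2 : 1 - δ₀ ≤ (π.prod U).real A := by
      refine h1.trans (measureReal_mono fun x hx => ?_)
      simp only [Set.mem_ofPred_eq, A] at hx ⊢
      nlinarith
    exact ENNReal.ofReal_le_of_le_toReal h2
  -- a sample from `ρ` consists almost surely of entries of `S`, and some such sample is at least
  -- as good as the average one
  let N₀ : Set (Fin m₀ → X × ℤˣ) := ⋃ j, Function.eval j ⁻¹' (Set.range S)ᶜ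
  have hN₀ : π N₀ = 0 := by
    refine measure_iUnion_null fun j => Measure.pi_eval_preimage_null _ ?_
    rw [hρapply]
    simp
  rw [Measure.prod_apply hAmeas] at hA
  obtain ⟨S', hS', hle⟩ := exists_notMem_null_lintegral_le (μ := π) (N := N₀)
    (f := fun S' => U (Prod.mk S' ⁻¹' A))
    ((lintegral_mono fun _ => prob_le_one).trans_lt (by simp)).ne hN₀
  have hrange : ∀ j, ∃ i, S i = S' j := by
    intro j
    by_contra hj
    exact hS' (Set.mem_iUnion.2 ⟨j, by simpa using hj⟩)
  choose I hI using hrange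
  refine ⟨I, ?_⟩
  have hS'eq : (fun j => S (I j)) = S' := funext hI
  have hset : {b | ¬(γ₀ - ε₀) * w₁
      ≤ ∑ i ∈ G, w i * labelVal (W m₀ (fun j => S (I j)) b (S i).1 * (S i).2)}
      = (Prod.mk S' ⁻¹' A)ᶜ := by
    ext b
    simp only [Set.mem_ofPred_eq, Set.mem_compl_iff, Set.mem_preimage, A, hcorr, hS'eq,
      le_div_iff₀ hw₁0]
  rw [hset, prob_compl_eq_one_sub (measurable_prodMk_left hAmeas)]
  refine tsub_le_iff_right.2 ?_
  calc (1 : ENNReal) = ENNReal.ofReal (δ₀ + (1 - δ₀)) := by simp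
    _ ≤ ENNReal.ofReal δ₀ + ENNReal.ofReal (1 - δ₀) := ENNReal.ofReal_add_le
    _ ≤ _ := by gcongr; exact hA.trans hle

/-- Boosting with fresh seeds in every round: up to probability `R * δ₀ ^ M`, one can select one
call per round such that the selected hypotheses have positive total margin at all examples that
`f` labels correctly. -/
lemma measure_not_exists_margin_le {X B : Type*} [Countable X] [MeasurableSpace X]
    [MeasurableSingletonClass X] [MeasurableSpace B] {U : Measure B} [IsProbabilityMeasure U]
    {F H : Set (X → ℤˣ)} {γ₀ ε₀ δ₀ θ : ℝ} {m₀ : ℕ} {W : Learner X B}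
    (hW : IsAgnosticWeakLearner F H γ₀ ε₀ δ₀ m₀ U W) (hγ : 0 ≤ γ₀)
    (hθγ : θ = (γ₀ - ε₀) / 2) (hθ : 0 < θ) (hθ1 : θ ≤ 1 / 2) {N : ℕ} (hN : 1 ≤ N)
    (S : Fin N → X × ℤˣ) {f : X → ℤˣ} (hf : f ∈ F) (R : ℕ) {M : ℕ} (hM : 1 ≤ M) :
    (Measure.pi fun _ : Fin R × (Fin m₀ → Fin N) × Fin M => U)
      {seed | ¬∃ j : Fin R → (Fin m₀ → Fin N) × Fin M, ∀ i, f (S i).1 = (S i).2 →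
        23 / 16 * θ ^ 2 * R - Real.log N ≤ θ * ∑ r, labelVal
          (W m₀ (fun k => S ((j r).1 k)) (seed (r, j r)) (S i).1 * (S i).2)}
      ≤ R * ENNReal.ofReal δ₀ ^ M := by
  classical
  let J := (Fin m₀ → Fin N) × Fin M
  -- only the signs of the margins on `S` matter; these patterns form a finite space, so that
  -- choices that depend on them raise no measurability issue
  let pat : J → B → Fin N → ℤˣ := fun c b i =>
    W m₀ (fun k => S (c.1 k)) b (S i).1 * (S i).2
  have hpat : ∀ c, Measurable (pat c) := fun c => measurable_pi_lambda _ fun i =>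
    (Measurable.of_discrete (f := fun y : ℤˣ => y * (S i).2)).comp
      (hW.measurable_seed m₀ _ (S i).1)
  let ν : J → Measure (Fin N → ℤˣ) := fun c => U.map (pat c)
  have hν : ∀ c, IsProbabilityMeasure (ν c) := fun c =>
    Measure.isProbabilityMeasure_map (hpat c).aemeasurable
  let P : Measure (J → Fin N → ℤˣ) := Measure.pi ν
  let Ψ : (Fin R × J → B) → Fin R → J → Fin N → ℤˣ := fun seed r c => pat c (seed (r, c))
  have hΨm : Measurable Ψ := measurable_pi_lambda _ fun r => measurable_pi_lambda _ fun c =>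
    (hpat c).comp (measurable_pi_apply _)
  have hΨ : (Measure.pi fun _ : Fin R × J => U).map Ψ = Measure.pi fun _ : Fin R => P := by
    refine Measure.ext_of_singleton fun ω => ?_
    rw [Measure.map_apply hΨm (measurableSet_singleton _)]
    have h1 : Ψ ⁻¹' {ω} = Set.univ.pi fun x : Fin R × J => pat x.2 ⁻¹' {ω x.1 x.2} := by
      ext seed
      simp only [Set.mem_preimage, Set.mem_singleton_iff, Set.mem_univ_pi, Prod.forall, Ψ,
        funext_iff]
    rw [h1, Measure.pi_pi, Measure.pi_singleton, Fintype.prod_prod_type]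
    refine Finset.prod_congr rfl fun r _ => ?_
    rw [Measure.pi_singleton]
    exact Finset.prod_congr rfl fun c _ =>
      (Measure.map_apply (hpat c) (measurableSet_singleton _)).symm
  let G : Finset (Fin N) := Finset.univ.filter fun i => f (S i).1 = (S i).2
  rcases G.eq_empty_or_nonempty with hG | hG
  · refine (measure_mono (t := ∅) ?_).trans (by simp)
    intro seed hs
    refine hs ⟨fun _ => (fun _ => ⟨0, hN⟩, ⟨0, hM⟩), fun i hi => ?_⟩
    have : i ∈ G := by simpa [G] using hi
    simp [hG] at this
  have hround : ∀ w : Fin N → ℝ, (∀ i ∈ G, 0 < w i) → P {o | ¬∃ c,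
      ∑ i ∈ G, w i * Real.exp (-θ * labelVal (o c i))
        ≤ Real.exp (-(23 / 16) * θ ^ 2) * ∑ i ∈ G, w i} ≤ ENNReal.ofReal δ₀ ^ M := by
    intro w hw
    obtain ⟨I, hI⟩ := exists_subsample_of_isAgnosticWeakLearner hW hγ S hf G hG
      (fun i hi => by simpa [G] using hi) w hw
    let Q : Set (Fin N → ℤˣ) := {v | ¬(γ₀ - ε₀) * ∑ i ∈ G, w i ≤ ∑ i ∈ G, w i * labelVal (v i)}
    -- a round can only fail if all `M` independent calls on the subsample `I` fail
    have hsub : {o : J → Fin N → ℤˣ | ¬∃ c, ∑ i ∈ G, w i * Real.exp (-θ * labelVal (o c i))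
        ≤ Real.exp (-(23 / 16) * θ ^ 2) * ∑ i ∈ G, w i}
        ⊆ Set.univ.pi fun c => if c.1 = I then Q else Set.univ := by
      intro o ho c _
      dsimp only
      split_ifs
      · intro hc
        refine ho ⟨c, sum_mul_exp_le_of_edge G w hw _ hθ hθ1 ?_⟩
        rw [hθγ, mul_div_cancel₀ _ two_ne_zero]
        exact hc
      · trivial
    refine (measure_mono hsub).trans ?_
    rw [Measure.pi_pi, Fintype.prod_prod_type]
    have h1 : ∀ I', ∏ m : Fin M, ν (I', m) (if I' = I then Q else Set.univ)
        ≤ if I' = I then ENNReal.ofReal δ₀ ^ M else 1 := by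
      intro I'
      split_ifs with h
      · subst h
        calc ∏ m : Fin M, ν (I', m) Q ≤ ∏ _m : Fin M, ENNReal.ofReal δ₀ := by
              refine Finset.prod_le_prod' fun m _ => ?_
              rw [Measure.map_apply (hpat _) .of_discrete]
              exact hI
          _ = ENNReal.ofReal δ₀ ^ M := by simp
      · simp
    refine (Finset.prod_le_prod' fun I' _ => h1 I').trans ?_
    rw [Finset.prod_ite_eq']
    simp
  have hboost := measure_not_exists_boosted_le P G θ _ (Real.exp_pos _).le _ hround R
    (fun _ => 1) (fun _ _ => one_pos)
  rw [← hΨ, Measure.map_apply hΨm (Set.to_countable _).measurableSet] at hboost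
  refine (measure_mono fun seed hs => ?_).trans hboost
  rintro ⟨j, hj⟩
  refine hs ⟨j, fun i hi => ?_⟩
  have hiG : i ∈ G := by simpa [G] using hi
  have hN0 : (0 : ℝ) < N := by exact_mod_cast hN
  -- a single term of the potential is at most the whole potential, at most `N`
  have h2 : Real.exp (-θ * ∑ r, labelVal (pat (j r) (seed (r, j r)) i))
      ≤ Real.exp (-(23 / 16) * θ ^ 2) ^ R * N := by
    simp only [one_mul] at hj
    refine (Finset.single_le_sum (f := fun i =>
      Real.exp (-θ * ∑ r, labelVal (pat (j r) (seed (r, j r)) i)))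
      (fun _ _ => (Real.exp_pos _).le) hiG).trans (hj.trans ?_)
    gcongr
    simpa using Finset.card_le_univ G
  rw [← Real.exp_nat_mul] at h2
  have h3 := Real.log_le_log (Real.exp_pos _) h2
  rw [Real.log_mul (Real.exp_pos _).ne' hN0.ne', Real.log_exp, Real.log_exp] at h3
  simp only [pat] at h3
  linarith

/-! ### Combinations that agree with a reference classifier on the first half of the sample -/

lemma log_le_sq_mul_numRounds (n : ℕ) {θ : ℝ} (hθ : 0 < θ) :
    Real.log n ≤ θ ^ 2 * numRounds n θ := by
  have h : Real.log n / θ ^ 2 ≤ numRounds n θ := Nat.le_ceil _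
  rwa [div_le_iff₀' (by positivity)] at h

lemma one_le_numRounds {n : ℕ} (hn : 2 ≤ n) {θ : ℝ} (hθ : 0 < θ) : 1 ≤ numRounds n θ := by
  have h : 0 < Real.log n := Real.log_pos (by exact_mod_cast hn)
  exact Nat.one_le_iff_ne_zero.2 (Nat.ceil_pos.2 (by positivity)).ne'

lemma log_inv_pos {δ₀ : ℝ} (hδ₀ : δ₀ ∈ Set.Ioo (0 : ℝ) 1) : 0 < Real.log (1 / δ₀) :=
  Real.log_pos (by rw [lt_div_iff₀ hδ₀.1]; linarith [hδ₀.2])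

lemma log_five_mul_numRounds_div_pos {n : ℕ} (hn : 2 ≤ n) {θ δ : ℝ} (hθ : 0 < θ)
    (hδ : δ ∈ Set.Ioo (0 : ℝ) 1) : 0 < Real.log (5 * numRounds n θ / δ) := by
  have h : (1 : ℝ) ≤ numRounds n θ := by exact_mod_cast one_le_numRounds hn hθ
  exact Real.log_pos (by rw [lt_div_iff₀ hδ.1]; linarith [hδ.2])

lemma one_le_numRepeats {n : ℕ} (hn : 2 ≤ n) {θ δ δ₀ : ℝ} (hθ : 0 < θ)
    (hδ : δ ∈ Set.Ioo (0 : ℝ) 1) (hδ₀ : δ₀ ∈ Set.Ioo (0 : ℝ) 1) : 1 ≤ numRepeats n θ δ δ₀ := by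
  have h1 := log_five_mul_numRounds_div_pos hn hθ hδ
  have h2 := log_inv_pos hδ₀
  exact Nat.one_le_iff_ne_zero.2 (Nat.ceil_pos.2 (by positivity)).ne'

lemma one_le_numCombined {n : ℕ} (hn : 2 ≤ n) {θ : ℝ} (hθ : 0 < θ) (dstar : ℕ) :
    1 ≤ numCombined n θ dstar := by
  have h : (1 : ℝ) ≤ numRounds n θ := by exact_mod_cast one_le_numRounds hn hθ
  refine Nat.one_le_iff_ne_zero.2 (Nat.ceil_pos.2 (lt_min (by linarith) ?_)).ne'
  positivity

/-- The number of repetitions makes all rounds succeed up to probability `δ / 5`. -/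
lemma numRounds_mul_pow_numRepeats_le {n : ℕ} (hn : 2 ≤ n) {θ δ δ₀ : ℝ} (hθ : 0 < θ)
    (hδ : δ ∈ Set.Ioo (0 : ℝ) 1) (hδ₀ : δ₀ ∈ Set.Ioo (0 : ℝ) 1) :
    numRounds n θ * δ₀ ^ numRepeats n θ δ δ₀ ≤ δ / 5 := by
  have hR : (1 : ℝ) ≤ numRounds n θ := by exact_mod_cast one_le_numRounds hn hθ
  have h2 := log_inv_pos hδ₀
  have h3 : Real.log (5 * numRounds n θ / δ) / Real.log (1 / δ₀) ≤ numRepeats n θ δ δ₀ :=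
    Nat.le_ceil _
  rw [div_le_iff₀ h2] at h3
  generalize numRepeats n θ δ δ₀ = M at h3 ⊢
  have hpos : 0 < 5 * numRounds n θ / δ := div_pos (by linarith) hδ.1
  have h4 : δ₀ ^ M ≤ δ / (5 * numRounds n θ) := by
    rw [← Real.exp_log hδ₀.1, ← Real.exp_nat_mul, ← Real.exp_log (div_pos hδ.1 (by linarith)),
      Real.exp_le_exp]
    rw [one_div, Real.log_inv, mul_neg] at h3
    have h5 : Real.log (δ / (5 * numRounds n θ)) = -Real.log (5 * numRounds n θ / δ) := by
      rw [← Real.log_inv, inv_div]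
    rw [h5]
    linarith
  calc numRounds n θ * δ₀ ^ M
      ≤ numRounds n θ * (δ / (5 * numRounds n θ)) := by gcongr
    _ = δ / 5 := by field_simp

lemma sgn_eq_of_pos {y : ℤˣ} {r : ℝ} (h : 0 < r * labelVal y) : sgn r = y := by
  rcases Int.units_eq_one_or y with rfl | rfl
  · rw [labelVal_one] at h
    exact if_pos (by linarith)
  · rw [labelVal_neg_one] at h
    exact if_neg (by linarith)

lemma labelVal_mul (a b : ℤˣ) : labelVal (a * b) = labelVal a * labelVal b := by
  simp [labelVal]

/-- Of `R = numRounds n θ` hypotheses with average margin at least `7 θ / 16` on a set of examples,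
some `T = numCombined n θ dstar` (with repetitions) have positive total margin: either `T = R`, or
`T` is large enough for a uniform approximation of the dual class. -/
lemma exists_subfamily_margin_pos {X : Type*} {H : Set (X → ℤˣ)} {dstar : ℕ}
    (hdual : VCdim (dualClass H) ≤ dstar) {n : ℕ} (hn : 2 ≤ n) {θ : ℝ} (hθ : 0 < θ)
    (h : Fin (numRounds n θ) → X → ℤˣ) (hH : ∀ r, h r ∈ H) {N : ℕ} (S : Fin N → X × ℤˣ)
    (G : Set (Fin N))
    (hmargin : ∀ i ∈ G, 7 / 16 * θ * numRounds n θ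
      ≤ ∑ r, labelVal (h r (S i).1 * (S i).2)) :
    ∃ t : Fin (numCombined n θ dstar) → Fin (numRounds n θ), ∀ i ∈ G,
      0 < (∑ j, labelVal (h (t j) (S i).1)) * labelVal (S i).2 := by
  have hR := one_le_numRounds hn hθ
  have hR1 : (1 : ℝ) ≤ numRounds n θ := by exact_mod_cast hR
  rcases le_or_gt (numRounds n θ : ℝ) (260 ^ 2 * ((4 * dstar + 2) / θ ^ 2)) with hle | hlt
  · have hT : numCombined n θ dstar = numRounds n θ := by
      rw [numCombined, min_eq_left hle, Nat.ceil_natCast]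
    refine ⟨Fin.cast hT, fun i hi => ?_⟩
    rw [Finset.sum_mul]
    have h1 : ∑ j, labelVal (h (Fin.cast hT j) (S i).1) * labelVal (S i).2
        = ∑ r, labelVal (h r (S i).1 * (S i).2) := by
      rw [← Equiv.sum_comp (finCongr hT)]
      exact Finset.sum_congr rfl fun j _ => (labelVal_mul _ _).symm
    rw [h1]
    exact lt_of_lt_of_le (by positivity) (hmargin i hi)
  · set T := numCombined n θ dstar with hTdef
    have hT1 : 1 ≤ T := one_le_numCombined hn hθ dstar
    have hT0 : (0 : ℝ) < T := by exact_mod_cast hT1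
    have hTle : 260 ^ 2 * ((4 * dstar + 2) / θ ^ 2) ≤ (T : ℝ) := by
      rw [hTdef, numCombined, min_eq_right hlt.le]; exact Nat.le_ceil _
    set D : ℕ := max dstar 1 with hD
    have hD1 : (D : ℝ) * 2 ≤ 4 * dstar + 2 := by
      rw [hD]; push_cast
      rcases le_total (dstar : ℝ) 1 with h | h
      · rw [max_eq_right h]; have : (0 : ℝ) ≤ dstar := by positivity
        linarith
      · rw [max_eq_left h]; linarith
    -- `7 / 704 = 7 / 16 / 44`, and `(704 / 7) ^ 2 < 260 ^ 2 * 2`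
    have hκ : 44 * (√D * √T) < 7 / 16 * θ * T := by
      have hsT : √(T : ℝ) * √T = T := Real.mul_self_sqrt hT0.le
      have hsT0 : 0 < √(T : ℝ) := Real.sqrt_pos.2 hT0
      have h1 : √(D : ℝ) < 7 / 704 * θ * √T := by
        rw [← Real.sqrt_sq (show 0 ≤ 7 / 704 * θ by positivity), ← Real.sqrt_mul (by positivity)]
        refine Real.sqrt_lt_sqrt (by positivity) ?_
        have h2 : 260 ^ 2 * (4 * (dstar : ℝ) + 2) ≤ T * θ ^ 2 := by
          rw [← div_le_iff₀ (by positivity), mul_div_assoc]; exact hTle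
        have h3 : (1 : ℝ) ≤ D := by rw [hD]; exact_mod_cast le_max_right _ _
        nlinarith
      nlinarith
    have hvc : VCdim (dualClass H) ≤ D := hdual.trans (by exact_mod_cast le_max_left _ _)
    obtain ⟨t, ht⟩ := exists_uniform_approximation (ι := Fin N) hvc (le_max_right _ _) hT1 hR
      (fun r => (⟨h r, hH r⟩ : H)) (fun i g => g.1 (S i).1) (fun i => ⟨(S i).1, rfl⟩) hκ
    refine ⟨t, fun i hi => ?_⟩
    have h1 := ht i
    have h2 := hmargin i hi
    simp only [labelVal_mul, ← Finset.sum_mul] at h2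
    dsimp only at h1
    have h3 : 7 / 16 * θ ≤ (∑ r, labelVal (h r (S i).1)) / numRounds n θ * labelVal (S i).2 := by
      rw [div_mul_eq_mul_div (∑ r, labelVal (h r (S i).1)), le_div_iff₀ (by linarith)]; exact h2
    set a := ∑ j, labelVal (h (t j) (S i).1)
    set b := (∑ r, labelVal (h r (S i).1)) / (numRounds n θ : ℝ)
    have h4 := abs_lt.1 h1
    have h5 : 7 / 16 * θ * T ≤ T * (b * labelVal (S i).2) := by
      rw [mul_comm]; gcongr
    rcases Int.units_eq_one_or (S i).2 with hy | hy
    · rw [hy, labelVal_one] at h5 ⊢; linarith [h4.1]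
    · rw [hy, labelVal_neg_one] at h5 ⊢; linarith [h4.2]

/-- For every sample, up to probability `δ / 5` over the seeds, the search space contains a
combination that is correct wherever `f` is correct on the first half of the sample. -/
lemma measure_not_exists_consistent_le {X B : Type*} [Countable X] [MeasurableSpace X]
    [MeasurableSingletonClass X] [MeasurableSpace B] {U : Measure B} [IsProbabilityMeasure U]
    {F H : Set (X → ℤˣ)} {γ₀ ε₀ δ₀ θ δ : ℝ} {m₀ dstar : ℕ} {W : Learner X B}
    (hW : IsAgnosticWeakLearner F H γ₀ ε₀ δ₀ m₀ U W) (hγ : 0 ≤ γ₀)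
    (hδ₀ : δ₀ ∈ Set.Ioo (0 : ℝ) 1) (hδ : δ ∈ Set.Ioo (0 : ℝ) 1)
    (hθγ : θ = (γ₀ - ε₀) / 2) (hθ : 0 < θ) (hθ1 : θ ≤ 1 / 2)
    (hdual : VCdim (dualClass H) ≤ dstar) {n : ℕ} (hn : 2 ≤ n)
    (S : Fin n → X × ℤˣ) {f : X → ℤˣ} (hf : f ∈ F) :
    (Measure.pi fun _ : CallIndex n m₀ θ δ δ₀ => U)
      {seed | ¬∃ v ∈ signAvgClass (numCombined n θ dstar) (hypPool S W m₀ θ δ δ₀ seed),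
        ∀ i, f (firstHalf S i).1 = (firstHalf S i).2 →
          v (firstHalf S i).1 = (firstHalf S i).2} ≤ ENNReal.ofReal (δ / 5) := by
  have hN : 1 ≤ n / 2 := by omega
  have h1 := measure_not_exists_margin_le hW hγ hθγ hθ hθ1 hN (firstHalf S) hf (numRounds n θ)
    (one_le_numRepeats hn hθ hδ hδ₀)
  refine (measure_mono fun seed hs => ?_).trans (h1.trans ?_)
  · rintro ⟨j, hj⟩
    have hlogN : Real.log (n / 2 : ℕ) ≤ Real.log n := by
      refine Real.log_le_log (by exact_mod_cast hN) ?_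
      exact_mod_cast Nat.div_le_self n 2
    have hlog := log_le_sq_mul_numRounds n hθ
    obtain ⟨t, ht⟩ := exists_subfamily_margin_pos hdual hn hθ
      (fun r => W m₀ (fun k => firstHalf S ((j r).1 k)) (seed (r, j r)))
      (fun r => hW.mem_base _ _ _) (firstHalf S) {i | f (firstHalf S i).1 = (firstHalf S i).2}
      (fun i hi => by
        have h2 := hj i hi
        -- `ln N ≤ θ ^ 2 * R` leaves the average margin `(23 / 16 - 1) * θ`
        refine le_of_mul_le_mul_left (le_trans ?_ h2) hθ
        linarith)
    have hT : (0 : ℝ) < numCombined n θ dstar := by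
      exact_mod_cast one_le_numCombined hn hθ dstar
    refine hs ⟨_, ⟨fun s => W m₀ (fun k => firstHalf S ((j (t s)).1 k)) (seed (t s, j (t s))),
      fun s => ⟨t s, (j (t s)).1, (j (t s)).2, rfl⟩, rfl⟩, fun i hi => ?_⟩
    refine sgn_eq_of_pos ?_
    rw [mul_assoc]
    exact mul_pos (by positivity) (ht i hi)
  · have h3 := numRounds_mul_pow_numRepeats_le hn hθ hδ hδ₀
    calc (numRounds n θ : ENNReal) * ENNReal.ofReal δ₀ ^ numRepeats n θ δ δ₀
        = ENNReal.ofReal (numRounds n θ * δ₀ ^ numRepeats n θ δ δ₀) := by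
          rw [ENNReal.ofReal_mul (by positivity), ENNReal.ofReal_natCast,
            ENNReal.ofReal_pow hδ₀.1.le]
      _ ≤ ENNReal.ofReal (δ / 5) := ENNReal.ofReal_le_ofReal h3

/-! ### The error of the empirical risk minimizers -/

lemma ncard_traces_signAvgClass_le {X ι : Type*} [Fintype ι] (H : Set (X → ℤˣ)) (T : ℕ)
    (p : ι → X) : (traces (signAvgClass T H) p).ncard ≤ (traces H p).ncard ^ T := by
  classical
  let 𝒯 : Finset (ι → ℤˣ) := (traces H p).toFinite.toFinset
  let Φ : (Fin T → ι → ℤˣ) → ι → ℤˣ := fun u j => sgn ((1 / T : ℝ) * ∑ t, labelVal (u t j))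
  let 𝒬 : Finset (Fin T → ι → ℤˣ) := Fintype.piFinset fun _ : Fin T => 𝒯
  have h1 : traces (signAvgClass T H) p ⊆ Φ '' (𝒬 : Set (Fin T → ι → ℤˣ)) := by
    rintro _ ⟨_, ⟨g, hg, rfl⟩, rfl⟩
    refine ⟨fun t j => g t (p j), ?_, rfl⟩
    simp only [𝒬, Finset.mem_coe, Fintype.mem_piFinset, 𝒯, Set.Finite.mem_toFinset]
    exact fun t => ⟨g t, hg t, rfl⟩
  calc (traces (signAvgClass T H) p).ncard
      ≤ (Φ '' (𝒬 : Set (Fin T → ι → ℤˣ))).ncard := Set.ncard_le_ncard h1 (Set.toFinite _)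
    _ ≤ (𝒬 : Set (Fin T → ι → ℤˣ)).ncard := Set.ncard_image_le (Set.toFinite _)
    _ = (traces H p).ncard ^ T := by
        rw [Set.ncard_coe_finset, Fintype.card_piFinset,
          Set.ncard_eq_toFinset_card _ (traces H p).toFinite]
        simp [𝒯]

/-- The composition of the members of `V` with a loss function `φ`, whose value `-1` stands for a
loss. -/
def lossClass {X : Type*} (φ : X × ℤˣ → ℤˣ → ℤˣ) (V : Set (X → ℤˣ)) : Set (X × ℤˣ → ℤˣ) :=
  (fun v z => φ z (v z.1)) '' V

lemma ncard_traces_lossClass_le {X ι : Type*} [Finite ι] (φ : X × ℤˣ → ℤˣ → ℤˣ)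
    (V : Set (X → ℤˣ)) (p : ι → X × ℤˣ) :
    (traces (lossClass φ V) p).ncard ≤ (traces V fun i => (p i).1).ncard := by
  have h : traces (lossClass φ V) p
      = (fun (u : ι → ℤˣ) i => φ (p i) (u i)) '' traces V fun i => (p i).1 := by
    simp only [traces, lossClass, Set.image_image]
  rw [h]
  exact Set.ncard_image_le (Set.toFinite _)

/-- The weights for which the deviation inequality compares the error and the empirical error up to
the relative error `η`. -/
lemma exp_add_exp_le_two (η : ℝ) :
    Real.exp (-(2 * η * (1 + η))) + Real.exp (2 * η * (1 - η)) ≤ 2 := by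
  have h1 := Real.cosh_le_exp_half_sq (2 * η)
  rw [Real.cosh_eq, show (2 * η) ^ 2 / 2 = 2 * η ^ 2 by ring] at h1
  have h2 : Real.exp (-(2 * η * (1 + η))) = Real.exp (-(2 * η ^ 2)) * Real.exp (-(2 * η)) := by
    rw [← Real.exp_add]; congr 1; ring
  have h3 : Real.exp (2 * η * (1 - η)) = Real.exp (-(2 * η ^ 2)) * Real.exp (2 * η) := by
    rw [← Real.exp_add]; congr 1; ring
  have h4 : Real.exp (-(2 * η ^ 2)) * Real.exp (2 * η ^ 2) = 1 := by
    rw [← Real.exp_add]; simp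
  rw [h2, h3]
  nlinarith [Real.exp_pos (-(2 * η ^ 2))]

/-- Restricting an i.i.d. sample to some of its indices gives an i.i.d. sample. -/
lemma measurePreserving_comp_embedding {Z : Type*} [MeasurableSpace Z] (D : Measure Z)
    [IsProbabilityMeasure D] {N n : ℕ} (e : Fin N ↪ Fin n) :
    MeasurePreserving (fun (S : Fin n → Z) i => S (e i)) (Measure.pi fun _ : Fin n => D)
      (Measure.pi fun _ : Fin N => D) := by
  have hm : Measurable fun (S : Fin n → Z) i => S (e i) :=
    measurable_pi_lambda _ fun i => measurable_pi_apply _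
  refine ⟨hm, (Measure.pi_eq fun s hs => ?_).symm⟩
  rw [Measure.map_apply hm (.univ_pi hs)]
  let t : Fin n → Set Z := Function.extend e s fun _ => Set.univ
  have ht : ∀ i, t (e i) = s i := fun i => e.injective.extend_apply _ _ i
  have ht' : ∀ k, (¬∃ i, e i = k) → t k = Set.univ := fun k hk =>
    Function.extend_apply' _ _ k hk
  have h1 : (fun (S : Fin n → Z) i => S (e i)) ⁻¹' Set.univ.pi s = Set.univ.pi t := by
    ext S
    simp only [Set.mem_preimage, Set.mem_univ_pi]
    refine ⟨fun h k => ?_, fun h i => ht i ▸ h (e i)⟩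
    by_cases hk : ∃ i, e i = k
    · obtain ⟨i, rfl⟩ := hk
      rw [ht]; exact h i
    · rw [ht' k hk]; trivial
  rw [h1, Measure.pi_pi, ← Finset.prod_subset (Finset.subset_univ (Finset.univ.map e)),
    Finset.prod_map]
  · simp only [ht]
  · intro k _ hk
    rw [ht' k (by simpa using hk), measure_univ]

lemma measurePreserving_firstHalf {Z : Type*} [MeasurableSpace Z] (D : Measure Z)
    [IsProbabilityMeasure D] (n : ℕ) :
    MeasurePreserving (firstHalf : (Fin n → Z) → _) (Measure.pi fun _ : Fin n => D)
      (Measure.pi fun _ : Fin (n / 2) => D) :=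
  measurePreserving_comp_embedding D
    ⟨fun i => ⟨i, by omega⟩, fun i j h => by simpa [Fin.ext_iff] using h⟩

lemma measurePreserving_secondHalf {Z : Type*} [MeasurableSpace Z] (D : Measure Z)
    [IsProbabilityMeasure D] (n : ℕ) :
    MeasurePreserving (secondHalf : (Fin n → Z) → _) (Measure.pi fun _ : Fin n => D)
      (Measure.pi fun _ : Fin (n / 2) => D) :=
  measurePreserving_comp_embedding D
    ⟨fun i => ⟨n / 2 + i, by omega⟩, fun i j h => by simpa [Fin.ext_iff] using h⟩

/-- A bound for all sections bounds the measure of a set, measurable or not, if the first factor is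
countable. -/
lemma prod_le_of_forall_section_le {α β : Type*} [Countable α] [MeasurableSpace α]
    [MeasurableSingletonClass α] [MeasurableSpace β] (μ : Measure α) [IsProbabilityMeasure μ]
    (ν : Measure β) [SFinite ν] (E : α → Set β) (c : ENNReal) (h : ∀ a, ν (E a) ≤ c) :
    (μ.prod ν) {x | x.2 ∈ E x.1} ≤ c := by
  have h1 : {x : α × β | x.2 ∈ E x.1} ⊆ ⋃ a, ({a} : Set α) ×ˢ E a := by
    rintro ⟨a, b⟩ hb
    exact Set.mem_iUnion.2 ⟨a, rfl, hb⟩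
  calc (μ.prod ν) {x | x.2 ∈ E x.1} ≤ ∑' a, (μ.prod ν) (({a} : Set α) ×ˢ E a) :=
        (measure_mono h1).trans (measure_iUnion_le _)
    _ ≤ ∑' a, c * μ {a} := by
        refine ENNReal.tsum_le_tsum fun a => ?_
        rw [Measure.prod_prod, mul_comm]
        gcongr
        exact h a
    _ = c := by rw [← lintegral_countable' fun _ => c]; simp

lemma one_sub_le_real_of_compl_le {α : Type*} [MeasurableSpace α] (μ : Measure α)
    [IsProbabilityMeasure μ] {A : Set α} {δ : ℝ} (hδ : 0 ≤ δ) (h : μ Aᶜ ≤ ENNReal.ofReal δ) :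
    1 - δ ≤ μ.real A := by
  have h1 : (1 : ENNReal) ≤ μ A + μ Aᶜ := by
    rw [← measure_univ (μ := μ), ← Set.union_compl_self A]; exact measure_union_le _ _
  have h2 : μ.real Aᶜ ≤ δ := ENNReal.toReal_le_of_le_ofReal hδ h
  have h3 := ENNReal.toReal_mono (by simp) h1
  rw [ENNReal.toReal_add (by simp) (by simp)] at h3
  simp only [ENNReal.toReal_one] at h3
  simp only [Measure.real] at h2 ⊢
  linarith

lemma err_eq_real_loss {X : Type*} [MeasurableSpace X] (D : Measure (X × ℤˣ)) (v : X → ℤˣ) :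
    err D v = D.real {z | v z.1 * z.2 = -1} := by
  unfold err
  congr 1
  ext z
  simp only [Set.mem_ofPred_eq]
  rcases Int.units_eq_one_or (v z.1) with h1 | h1 <;>
    rcases Int.units_eq_one_or z.2 with h2 | h2 <;> simp [h1, h2, units_ne_neg_self]

lemma mul_empErr_eq_sum {X : Type*} {k : ℕ} (hk : 1 ≤ k) (S : Fin k → X × ℤˣ) (v : X → ℤˣ) :
    k * empErr S v = ∑ i, negInd (v (S i).1 * (S i).2) := by
  have hk0 : (k : ℝ) ≠ 0 := by positivity
  rw [empErr, mul_div_cancel₀ _ hk0, Finset.card_filter]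
  push_cast
  refine Finset.sum_congr rfl fun i _ => ?_
  rcases Int.units_eq_one_or (v (S i).1) with h1 | h1 <;>
    rcases Int.units_eq_one_or (S i).2 with h2 | h2 <;> simp [h1, h2, negInd, units_ne_neg_self]

/-- The two relative deviation bounds with parameter `η = √(x / e₁)`, where `e₁ = e + 25 x` and `m`
is half of an empirical error, combine to a bound for the error `r` of a minimizer. -/
lemma err_le_of_relative_deviations {e x r r' m : ℝ} (he : 0 ≤ e) (hx : 0 < x)
    (hr' : r' ≤ e + 25 * x)
    (h1 : √(x / (e + 25 * x)) * (1 - √(x / (e + 25 * x))) * r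
      ≤ x + √(x / (e + 25 * x)) * (1 + √(x / (e + 25 * x))) * m)
    (h2 : √(x / (e + 25 * x)) * (1 - √(x / (e + 25 * x))) * m
      ≤ x + √(x / (e + 25 * x)) * (1 + √(x / (e + 25 * x))) * r') :
    r ≤ e + 10 * √(e * x) + 72 * x := by
  set e₁ := e + 25 * x with he₁
  set η := √(x / e₁) with hη
  have he₁0 : 0 < e₁ := by positivity
  have hη0 : 0 < η := Real.sqrt_pos.2 (by positivity)
  have hηsq : η ^ 2 * e₁ = x := by
    rw [hη, Real.sq_sqrt (by positivity)]; field_simp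
  -- the summand `25 * x` of `e₁` keeps `η` away from `1`
  have hη1 : η ≤ 1 / 5 := by
    rw [hη, ← Real.sqrt_sq (show (0 : ℝ) ≤ 1 / 5 by norm_num)]
    apply Real.sqrt_le_sqrt
    rw [div_le_iff₀ he₁0]; linarith
  have h3 : η * (1 - η) ^ 2 * r ≤ η * ((1 + 4 * η + η ^ 2) * e₁) := by
    have h4 := mul_le_mul_of_nonneg_left h1 (show 0 ≤ 1 - η by linarith)
    have h5 := mul_le_mul_of_nonneg_left h2 (show 0 ≤ 1 + η by linarith)
    have h6 := mul_le_mul_of_nonneg_left hr' (show 0 ≤ η * (1 + η) ^ 2 by positivity)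
    rw [← hηsq] at h4 h5
    nlinarith
  have h7 : (1 - η) ^ 2 * r ≤ (1 + 4 * η + η ^ 2) * e₁ := by
    rw [mul_assoc] at h3; exact le_of_mul_le_mul_left h3 hη0
  have h8 : 16 / 25 ≤ (1 - η) ^ 2 := by nlinarith
  have h9 : r ≤ e₁ + 75 / 8 * (η * e₁) := by
    have h10 : (1 - η) ^ 2 * r ≤ (1 - η) ^ 2 * (e₁ + 75 / 8 * (η * e₁)) := by
      nlinarith [mul_le_mul_of_nonneg_right h8 (mul_nonneg hη0.le he₁0.le)]
    exact le_of_mul_le_mul_left h10 (by linarith)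
  have h11 : η * e₁ ≤ √(e * x) + 5 * x := by
    have h12 : η * e₁ = √(x * e₁) := by
      rw [← Real.sqrt_sq (show 0 ≤ η * e₁ by positivity)]
      congr 1
      rw [← hηsq]; ring
    rw [h12]
    refine Real.sqrt_le_iff.2 ⟨by positivity, ?_⟩
    have h13 : √(e * x) ^ 2 = e * x := Real.sq_sqrt (by positivity)
    rw [he₁]
    nlinarith [mul_nonneg (Real.sqrt_nonneg (e * x)) hx.le]
  have := Real.sqrt_nonneg (e * x)
  linarith

/-- The error bound in terms of a bound `Γ` for the number of traces of the search space and an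
excess error `x`. -/
lemma one_sub_le_measure_boostOutputs {X B : Type*} [Countable X] [MeasurableSpace X]
    [MeasurableSingletonClass X] [MeasurableSpace B] {U : Measure B} [IsProbabilityMeasure U]
    {F H : Set (X → ℤˣ)} {γ₀ ε₀ δ₀ θ δ : ℝ} {m₀ dstar : ℕ} {W : Learner X B}
    (hW : IsAgnosticWeakLearner F H γ₀ ε₀ δ₀ m₀ U W) (hγ : 0 ≤ γ₀)
    (hδ₀ : δ₀ ∈ Set.Ioo (0 : ℝ) 1) (hδ : δ ∈ Set.Ioo (0 : ℝ) 1)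
    (hθγ : θ = (γ₀ - ε₀) / 2) (hθ : 0 < θ) (hθ1 : θ ≤ 1 / 2)
    (hdual : VCdim (dualClass H) ≤ dstar) {n : ℕ} (hn : 2 ≤ n) (heven : Even n)
    (D : Measure (X × ℤˣ)) [IsProbabilityMeasure D] {f : X → ℤˣ} (hf : f ∈ F) {Γ e x : ℝ}
    (hΓ : ∀ p : Fin (n / 2) ⊕ Fin (n / 2) → X,
      ((traces (signAvgClass (numCombined n θ dstar) H) p).ncard : ℝ) ≤ Γ)
    (he : 0 ≤ e) (hx : 0 < x) (hΓx : Γ * Real.exp (-(n * x)) ≤ δ / 5) (hfe : err D f ≤ e + x) :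
    1 - δ ≤ ((Measure.pi fun _ : Fin n => D).prod
        (Measure.pi fun _ : CallIndex n m₀ θ δ δ₀ => U)).real
      {p | ∀ v ∈ boostOutputs p.1 W m₀ θ δ δ₀ dstar p.2,
        err D v ≤ e + 10 * √(e * x) + 72 * x} := by
  classical
  set N := n / 2 with hN
  have hnN : (n : ℝ) = 2 * N := by
    obtain ⟨k, hk⟩ := heven
    have : n = 2 * N := by omega
    exact_mod_cast this
  have hN1 : 1 ≤ N := by omega
  have hN0 : (0 : ℝ) < N := by exact_mod_cast hN1
  set V := signAvgClass (numCombined n θ dstar) H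
  set η := √(x / (e + 25 * x)) with hη
  let φ : X × ℤˣ → ℤˣ → ℤˣ := fun z u => u * z.2
  -- `φf` only counts the errors at examples that `f` labels correctly
  let φf : X × ℤˣ → ℤˣ → ℤˣ := fun z u => if f z.1 = z.2 then u * z.2 else 1
  let bad : (X × ℤˣ → ℤˣ → ℤˣ) → ℝ → ℝ → Set (Fin N → X × ℤˣ) := fun φ α β =>
    {S | ∃ l ∈ lossClass φ V,
      n * x ≤ α * ∑ i, negInd (l (S i)) + β * (N * D.real {z | l z = -1})}
  have hbad : ∀ φ α β, Real.exp α + Real.exp β ≤ 2 →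
      (Measure.pi fun _ : Fin N => D) (bad φ α β) ≤ ENNReal.ofReal (δ / 5) := by
    intro φ α β hαβ
    refine (measure_exists_deviation_le D (lossClass φ V) (fun p => ?_) hαβ (n * x)).trans
      (ENNReal.ofReal_le_ofReal hΓx)
    refine le_trans ?_ (hΓ fun i => (p i).1)
    exact_mod_cast ncard_traces_lossClass_le φ V p
  -- on the first half, `η = 1 / 2` suffices since some combination has no `φf`-loss there
  let B₂ := bad φf (-(2 * (1 / 2) * (1 + 1 / 2))) (2 * (1 / 2) * (1 - 1 / 2))
  let B₃ := bad φ (-(2 * η * (1 + η))) (2 * η * (1 - η))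
  let B₄ := bad φ (2 * η * (1 - η)) (-(2 * η * (1 + η)))
  let E : (Fin n → X × ℤˣ) → Set (CallIndex n m₀ θ δ δ₀ → B) := fun S =>
    {seed | ¬∃ v ∈ signAvgClass (numCombined n θ dstar) (hypPool S W m₀ θ δ δ₀ seed),
        ∀ i, f (firstHalf S i).1 = (firstHalf S i).2 →
          v (firstHalf S i).1 = (firstHalf S i).2}
  set μ := (Measure.pi fun _ : Fin n => D).prod (Measure.pi fun _ : CallIndex n m₀ θ δ δ₀ => U)
  have hE : μ {p | p.2 ∈ E p.1} ≤ ENNReal.ofReal (δ / 5) :=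
    prod_le_of_forall_section_le _ _ E _ fun S =>
      measure_not_exists_consistent_le hW hγ hδ₀ hδ hθγ hθ hθ1 hdual hn S hf
  have hfst : MeasurePreserving Prod.fst μ (Measure.pi fun _ : Fin n => D) :=
    measurePreserving_fst
  have hfirst : ∀ A : Set (Fin N → X × ℤˣ), (Measure.pi fun _ : Fin N => D) A
      ≤ ENNReal.ofReal (δ / 5) → μ {p | firstHalf p.1 ∈ A} ≤ ENNReal.ofReal (δ / 5) := by
    intro A hA
    rwa [← ((measurePreserving_firstHalf D n).comp hfst).measure_preimage
      (MeasurableSet.of_discrete (s := A)).nullMeasurableSet] at hA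
  have hsecond : ∀ A : Set (Fin N → X × ℤˣ), (Measure.pi fun _ : Fin N => D) A
      ≤ ENNReal.ofReal (δ / 5) → μ {p | secondHalf p.1 ∈ A} ≤ ENNReal.ofReal (δ / 5) := by
    intro A hA
    rwa [← ((measurePreserving_secondHalf D n).comp hfst).measure_preimage
      (MeasurableSet.of_discrete (s := A)).nullMeasurableSet] at hA
  refine one_sub_le_real_of_compl_le μ hδ.1.le ?_
  have hcover : {p : (Fin n → X × ℤˣ) × (CallIndex n m₀ θ δ δ₀ → B) |
        ∀ v ∈ boostOutputs p.1 W m₀ θ δ δ₀ dstar p.2,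
          err D v ≤ e + 10 * √(e * x) + 72 * x}ᶜ
      ⊆ ({p | p.2 ∈ E p.1} ∪ {p | firstHalf p.1 ∈ B₂})
        ∪ ({p | secondHalf p.1 ∈ B₃} ∪ {p | secondHalf p.1 ∈ B₄}) := by
    rintro ⟨S, seed⟩ hp
    by_contra hnot
    simp only [Set.mem_union, Set.mem_ofPred_eq, not_or] at hnot
    obtain ⟨⟨hnE, hn2⟩, hn3, hn4⟩ := hnot
    refine hp fun v hv => ?_
    obtain ⟨v', hv', hcons⟩ := not_not.1 hnE
    obtain ⟨hvV, hvmin⟩ := hv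
    have hsubV : signAvgClass (numCombined n θ dstar) (hypPool S W m₀ θ δ δ₀ seed) ⊆ V := by
      rintro _ ⟨g, hg, rfl⟩
      refine ⟨g, fun t => ?_, rfl⟩
      obtain ⟨r, I, m, h⟩ := hg t
      rw [h]; exact hW.mem_base _ _ _
    -- the consistent combination `v'` is nearly as good as `f`
    have hp2 : D.real {z | φf z (v' z.1) = -1} ≤ 4 * x := by
      by_contra! hlt
      refine hn2 ⟨_, ⟨v', hsubV hv', rfl⟩, ?_⟩
      have hzero : ∑ i, negInd (φf (firstHalf S i) (v' (firstHalf S i).1)) = 0 := by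
        refine Finset.sum_eq_zero fun i _ => ?_
        simp only [φf]
        split_ifs with h
        · rw [hcons i h, Int.units_mul_self, negInd_one]
        · exact negInd_one
      simp only [hnN]
      nlinarith
    have hv'err : err D v' ≤ e + 25 * x := by
      have h1 : err D v' ≤ err D f + D.real {z | φf z (v' z.1) = -1} := by
        refine le_trans (measureReal_mono fun z hz => ?_) (measureReal_union_le _ _)
        by_cases h : f z.1 = z.2
        · right
          simp only [Set.mem_ofPred_eq, φf, if_pos h] at hz ⊢
          rcases Int.units_eq_one_or (v' z.1) with h1 | h1 <;>
            rcases Int.units_eq_one_or z.2 with h2 | h2 <;> simp_all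
        · left; exact h
      linarith
    -- the uniform deviation bounds on the second half
    have h3 := not_le.1 fun h => hn3 ⟨_, ⟨v, hsubV hvV, rfl⟩, h⟩
    have h4 := not_le.1 fun h => hn4 ⟨_, ⟨v', hsubV hv', rfl⟩, h⟩
    simp only [φ, ← err_eq_real_loss, ← mul_empErr_eq_sum hN1] at h3 h4
    have hmin := hvmin v' hv'
    rw [hnN] at h3 h4
    have hη0 : 0 ≤ η := Real.sqrt_nonneg _
    refine err_le_of_relative_deviations (m := empErr (secondHalf S) v') he hx hv'err ?_ ?_
    · rw [← hη]
      have h5 : η * (1 + η) * empErr (secondHalf S) v ≤ η * (1 + η) * empErr (secondHalf S) v' := by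
        gcongr
      have h6 : (2 * N) * (η * (1 - η) * err D v)
          ≤ (2 * N) * (x + η * (1 + η) * empErr (secondHalf S) v) := by
        linarith
      linarith [le_of_mul_le_mul_left h6 (by positivity)]
    · rw [← hη]
      have h6 : (2 * N) * (η * (1 - η) * empErr (secondHalf S) v')
          ≤ (2 * N) * (x + η * (1 + η) * err D v') := by
        linarith
      exact le_of_mul_le_mul_left h6 (by positivity)
  calc μ _ ≤ (μ {p | p.2 ∈ E p.1} + μ {p | firstHalf p.1 ∈ B₂})
        + (μ {p | secondHalf p.1 ∈ B₃} + μ {p | secondHalf p.1 ∈ B₄}) :=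
        (measure_mono hcover).trans ((measure_union_le _ _).trans
          (add_le_add (measure_union_le _ _) (measure_union_le _ _)))
    _ ≤ (ENNReal.ofReal (δ / 5) + ENNReal.ofReal (δ / 5))
        + (ENNReal.ofReal (δ / 5) + ENNReal.ofReal (δ / 5)) := by
        refine add_le_add (add_le_add hE (hfirst _ (hbad _ _ _ (exp_add_exp_le_two _))))
          (add_le_add (hsecond _ (hbad _ _ _ (exp_add_exp_le_two _)))
            (hsecond _ (hbad _ _ _ ?_)))
        rw [add_comm]; exact exp_add_exp_le_two _
    _ ≤ ENNReal.ofReal δ := by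
        have := hδ.1
        rw [← ENNReal.ofReal_add (by positivity) (by positivity),
          ← ENNReal.ofReal_add (by positivity) (by positivity)]
        exact ENNReal.ofReal_le_ofReal (by linarith)

/-! ### The growth of the search space -/

lemma one_le_Ln (x : ℝ) : 1 ≤ Ln x := by
  rw [Ln, Real.le_log_iff_exp_le (lt_max_of_lt_right (Real.exp_pos 1))]
  exact le_max_right _ _

/-- The logarithm of the Sauer–Shelah bound for the sign averages of `T` hypotheses is at most
`d' * Ln (10 * e * n / d')`, where `d' = 4 * T * d * ln (4 * e * T)`. -/
lemma mul_log_le_mul_Ln {T d n : ℕ} (hT : 1 ≤ T) (hd : 1 ≤ d) (hn : 1 ≤ n) {d' : ℝ}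
    (hd' : d' = 4 * T * d * Real.log (4 * Real.exp 1 * T)) :
    T * d * Real.log (Real.exp 1 * n / d) ≤ d' * Ln (10 * Real.exp 1 * n / d') := by
  have hT1 : (1 : ℝ) ≤ T := by exact_mod_cast hT
  have hd1 : (1 : ℝ) ≤ d := by exact_mod_cast hd
  have hn1 : (1 : ℝ) ≤ n := by exact_mod_cast hn
  have he := Real.exp_pos 1
  set l := Real.log (4 * Real.exp 1 * T) with hl
  have hl' : l = Real.log 4 + 1 + Real.log T := by
    rw [hl, Real.log_mul (by positivity) (by positivity), Real.log_mul (by norm_num) he.ne',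
      Real.log_exp]
  have hlogT : 0 ≤ Real.log T := Real.log_nonneg hT1
  have hlog4 : 0 < Real.log 4 := Real.log_pos (by norm_num)
  have hl1 : 1 ≤ l := by linarith
  have hlogl : Real.log l ≤ l := (Real.log_le_sub_one_of_pos (by linarith)).trans (by linarith)
  set L := Ln (10 * Real.exp 1 * n / d') with hL
  have hL1 : 1 ≤ L := one_le_Ln _
  have hd'0 : 0 < d' := by rw [hd']; positivity
  have h1 : Real.log (10 * Real.exp 1 * n / d') ≤ L := by
    rw [hL, Ln]
    exact Real.log_le_log (by positivity) (le_max_left _ _)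
  have h2 : Real.log (10 * Real.exp 1 * n / d')
      = Real.log (Real.exp 1 * n / d) + Real.log (5 / 2) - Real.log T - Real.log l := by
    rw [show 10 * Real.exp 1 * n / d' = Real.exp 1 * n / d * (5 / 2) / T / l by
      rw [hd']; field_simp; ring]
    rw [Real.log_div (by positivity) (by positivity), Real.log_div (by positivity) (by positivity),
      Real.log_mul (by positivity) (by positivity)]
  have h3 : 0 ≤ Real.log (5 / 2 : ℝ) := Real.log_nonneg (by norm_num)
  -- the factor `l` of `d'` costs `ln T + ln l ≤ 2 * l` inside the logarithm
  have h4 : Real.log (Real.exp 1 * n / d) ≤ L + 2 * l := by linarith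
  have h5 : L + 2 * l ≤ 4 * l * L := by nlinarith
  calc T * d * Real.log (Real.exp 1 * n / d) ≤ T * d * (4 * l * L) := by
        gcongr; exact h4.trans h5
    _ = d' * L := by rw [hd']; ring

lemma numCombined_eq (n : ℕ) (θ : ℝ) (dstar : ℕ) :
    ⌈min (Real.log n / θ ^ 2) (260 ^ 2 * (4 * dstar + 2) / θ ^ 2)⌉₊ = numCombined n θ dstar := by
  rw [numCombined, numRounds, mul_div_assoc]
  refine le_antisymm (Nat.ceil_mono (min_le_min_right _ (Nat.le_ceil _))) ?_
  rcases le_total (Real.log n / θ ^ 2) (260 ^ 2 * ((4 * dstar + 2) / θ ^ 2)) with h | h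
  · rw [min_eq_left h]
    exact Nat.ceil_le.2 (min_le_left _ _)
  · rw [min_eq_right h]
    exact Nat.ceil_mono (min_le_right _ _)

/-- The error bound of the algorithm. -/
theorem one_sub_le_measure_err_le {X B : Type*} [Countable X] [MeasurableSpace X]
    [MeasurableSingletonClass X] [MeasurableSpace B] {U : Measure B} [IsProbabilityMeasure U]
    {F H : Set (X → ℤˣ)} {γ₀ ε₀ δ₀ θ δ : ℝ} {m₀ d dstar : ℕ} {W : Learner X B}
    (hW : IsAgnosticWeakLearner F H γ₀ ε₀ δ₀ m₀ U W) (hF : F.Nonempty) (hγ : 0 ≤ γ₀)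
    (hδ₀ : δ₀ ∈ Set.Ioo (0 : ℝ) 1) (hδ : δ ∈ Set.Ioo (0 : ℝ) 1)
    (hθγ : θ = (γ₀ - ε₀) / 2) (hθ : 0 < θ) (hθ1 : θ ≤ 1 / 2)
    (hH : VCdim H ≤ d) (hdual : VCdim (dualClass H) ≤ dstar) {n : ℕ} (hn : 2 ≤ n)
    (heven : Even n) (D : Measure (X × ℤˣ)) [IsProbabilityMeasure D] {d' errStar : ℝ}
    (hd' : d' = 4 * numCombined n θ dstar * d
      * Real.log (4 * Real.exp 1 * numCombined n θ dstar))
    (hstar : errStar = ⨅ f : F, err D f) :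
    1 - δ ≤ ((Measure.pi fun _ : Fin n => D).prod
        (Measure.pi fun _ : CallIndex n m₀ θ δ δ₀ => U)).real
      {p | ∀ v ∈ boostOutputs p.1 W m₀ θ δ δ₀ dstar p.2,
        err D v ≤ errStar
          + 10 * √(errStar *
              ((d' * Ln (10 * Real.exp 1 * n / d') + Real.log (5 / δ)) / n))
          + 182 * ((d' * Ln (10 * Real.exp 1 * n / d') + 4 * Real.log (5 / δ)) / n)} := by
  set T := numCombined n θ dstar
  have hT : 1 ≤ T := one_le_numCombined hn hθ dstar
  have hT1 : (1 : ℝ) ≤ T := by exact_mod_cast hT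
  have hn0 : (0 : ℝ) < n := by positivity
  have hl : 0 ≤ Real.log (4 * Real.exp 1 * T) := by
    apply Real.log_nonneg
    have := Real.add_one_le_exp 1
    nlinarith
  have hd'0 : 0 ≤ d' := by rw [hd']; positivity
  set A := d' * Ln (10 * Real.exp 1 * n / d') with hA
  have hd'A : d' ≤ A := le_mul_of_one_le_right hd'0 (one_le_Ln _)
  have hlogδ : 0 < Real.log (5 / δ) :=
    Real.log_pos (by rw [lt_div_iff₀ hδ.1]; linarith [hδ.2])
  have hne : Nonempty F := hF.to_subtype
  have he : 0 ≤ errStar := by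
    rw [hstar]; exact le_ciInf fun _ => measureReal_nonneg
  rcases le_or_gt (n : ℝ) (182 * (A + 4 * Real.log (5 / δ))) with htriv | hnontriv
  · -- the bound is at least `1`
    have hall : {p : (Fin n → X × ℤˣ) × (CallIndex n m₀ θ δ δ₀ → B) |
        ∀ v ∈ boostOutputs p.1 W m₀ θ δ δ₀ dstar p.2,
          err D v ≤ errStar + 10 * √(errStar * ((A + Real.log (5 / δ)) / n))
            + 182 * ((A + 4 * Real.log (5 / δ)) / n)} = Set.univ := by
      refine Set.eq_univ_of_forall fun p v _ => ?_
      have h1 : (1 : ℝ) ≤ 182 * ((A + 4 * Real.log (5 / δ)) / n) := by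
        rw [← mul_div_assoc, le_div_iff₀ hn0, one_mul]; exact htriv
      have h2 : err D v ≤ 1 := measureReal_le_one
      have := Real.sqrt_nonneg (errStar * ((A + Real.log (5 / δ)) / n))
      linarith
    rw [hall, probReal_univ]
    linarith [hδ.1]
  · set x := (A + Real.log (5 / δ)) / n with hx
    have hx0 : 0 < x := div_pos (by linarith) hn0
    have hnx : n * x = A + Real.log (5 / δ) := by rw [hx]; field_simp
    obtain ⟨⟨f, hf⟩, hfe⟩ := exists_lt_of_ciInf_lt
      (show (⨅ f : F, err D f) < errStar + x by rw [← hstar]; linarith)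
    have hΓ : ∀ p : Fin (n / 2) ⊕ Fin (n / 2) → X,
        ((traces (signAvgClass T H) p).ncard : ℝ) ≤ Real.exp A := by
      intro p
      have h1 : ((traces (signAvgClass T H) p).ncard : ℝ) ≤ ((traces H p).ncard : ℝ) ^ T := by
        exact_mod_cast ncard_traces_signAvgClass_le H T p
      rcases Nat.eq_zero_or_pos d with rfl | hd
      · have h2 : ((traces H p).ncard : ℝ) ≤ 1 := by exact_mod_cast ncard_traces_le_one hH p
        refine h1.trans ((pow_le_one₀ (by positivity) h2).trans ?_)
        exact Real.one_le_exp (hd'0.trans hd'A)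
      · have hcard : Fintype.card (Fin (n / 2) ⊕ Fin (n / 2)) = n := by
          obtain ⟨k, hk⟩ := heven
          simp only [Fintype.card_sum, Fintype.card_fin]
          omega
        have hd1 : (1 : ℝ) ≤ d := by exact_mod_cast hd
        have hdn : d ≤ n := by
          have hl1 : 1 ≤ Real.log (4 * Real.exp 1 * T) := by
            rw [Real.le_log_iff_exp_le (by positivity)]
            nlinarith [Real.exp_pos 1]
          have h3 : (d : ℝ) ≤ d' := by
            rw [hd', show 4 * (T : ℝ) * d * Real.log (4 * Real.exp 1 * T)
              = 4 * (T * (d * Real.log (4 * Real.exp 1 * T))) by ring]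
            have h4 : 1 * ((d : ℝ) * 1) ≤ T * (d * Real.log (4 * Real.exp 1 * T)) := by gcongr
            linarith
          have h5 : (d : ℝ) ≤ n := by linarith
          exact_mod_cast h5
        have h2 := ncard_traces_le_pow hH hd (hcard.symm ▸ hdn) p
        rw [hcard] at h2
        calc ((traces (signAvgClass T H) p).ncard : ℝ)
            ≤ ((Real.exp 1 * n / d) ^ d) ^ T := h1.trans (by gcongr)
          _ = Real.exp (T * d * Real.log (Real.exp 1 * n / d)) := by
            rw [← pow_mul, mul_comm d T, ← Nat.cast_mul, Real.exp_nat_mul,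
              Real.exp_log (by positivity)]
          _ ≤ Real.exp A := Real.exp_le_exp.2 (mul_log_le_mul_Ln hT hd (by omega) hd')
    have hΓx : Real.exp A * Real.exp (-(n * x)) ≤ δ / 5 := by
      rw [← Real.exp_add, hnx, neg_add, add_neg_cancel_left, Real.exp_neg,
        Real.exp_log (div_pos (by norm_num) hδ.1), inv_div]
    have hmain := one_sub_le_measure_boostOutputs (θ := θ) (δ := δ) hW hγ hδ₀ hδ hθγ hθ hθ1 hdual
      hn heven D hf hΓ he hx0 hΓx hfe.le
    refine hmain.trans (measureReal_mono fun p hp v hv => (hp v hv).trans ?_)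
    have h6 : 72 * x ≤ 182 * ((A + 4 * Real.log (5 / δ)) / n) := by
      rw [hx, ← mul_div_assoc, ← mul_div_assoc]
      gcongr ?_ / _
      linarith
    linarith

open Counted

/-! ### Correctness and cost of the program -/

/-- All `k`-tuples of entries of the list `l`, in the order in which `Counted.forTuples` visits
them. -/
def tupleList {A : Type*} (l : List A) : (k : ℕ) → List (Fin k → A)
  | 0 => [Fin.elim0]
  | k + 1 => l.flatMap fun a => (tupleList l k).map (Fin.cons a)

lemma mem_tupleList {A : Type*} {l : List A} {k : ℕ} {I : Fin k → A} :
    I ∈ tupleList l k ↔ ∀ j, I j ∈ l := by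
  induction k with
  | zero => simpa [tupleList] using Subsingleton.elim _ _
  | succ k ih =>
    simp only [tupleList, List.mem_flatMap, List.mem_map, ih]
    constructor
    · rintro ⟨a, ha, I', hI', rfl⟩ j
      refine Fin.cases ?_ (fun j => ?_) j
      · simpa using ha
      · simpa using hI' j
    · exact fun h => ⟨I 0, h 0, Fin.tail I, fun j => h j.succ, Fin.cons_self_tail I⟩

lemma length_tupleList {A : Type*} (l : List A) (k : ℕ) :
    (tupleList l k).length = l.length ^ k := by
  induction k with
  | zero => rfl
  | succ k ih => simp [tupleList, List.length_flatMap, ih, pow_succ']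

lemma forEach_val {A St : Type*} (l : List A) (body : A → St → Counted St) (s : St) :
    (forEach l body s).val = l.foldl (fun s a => (body a s).val) s := by
  induction l generalizing s with
  | nil => rfl
  | cons a l ih => exact ih _

lemma forTuples_val {A St : Type*} (l : List A) (k : ℕ) (body : (Fin k → A) → St → Counted St)
    (s : St) :
    (forTuples l k body s).val = (tupleList l k).foldl (fun s I => (body I s).val) s := by
  induction k generalizing s with
  | zero => rfl
  | succ k ih =>
    simp only [forTuples, forEach_val, tupleList, List.foldl_flatMap, List.foldl_map, ih]

lemma forEach_calls {A St : Type*} (l : List A) (body : A → St → Counted St) (b : ℕ)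
    (h : ∀ a s, (body a s).calls = b) (s : St) : (forEach l body s).calls = l.length * b := by
  induction l generalizing s with
  | nil => simp [forEach, charge]
  | cons a l ih => simp only [forEach, Counted.bind, charge, h, ih, List.length_cons]; ring

lemma forTuples_calls {A St : Type*} (l : List A) (k : ℕ) (body : (Fin k → A) → St → Counted St)
    (b : ℕ) (h : ∀ I s, (body I s).calls = b) (s : St) :
    (forTuples l k body s).calls = l.length ^ k * b := by
  induction k generalizing s with
  | zero => simp [forTuples, h]
  | succ k ih =>
    rw [forTuples, forEach_calls l _ _ fun a s => ih _ (fun I s => h _ s) s, pow_succ']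
    ring

lemma forEach_time_le {A St : Type*} (l : List A) (body : A → St → Counted St) (b : ℕ)
    (h : ∀ a s, (body a s).time ≤ b) (s : St) :
    (forEach l body s).time ≤ l.length * (b + 1) := by
  induction l generalizing s with
  | nil => simp [forEach, charge]
  | cons a l ih =>
    have h1 := h a s
    have h2 := ih (body a s).val
    simp only [forEach, Counted.bind, charge, List.length_cons]
    calc 1 + (body a s).time + (forEach l body (body a s).val).time
        ≤ 1 + b + l.length * (b + 1) := by gcongr
      _ = (l.length + 1) * (b + 1) := by ring

lemma forTuples_time_le {A St : Type*} (l : List A) (k : ℕ)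
    (body : (Fin k → A) → St → Counted St) (b : ℕ) (h : ∀ I s, (body I s).time ≤ b) (s : St) :
    (forTuples l k body s).time + 1 ≤ (l.length + 1) ^ k * (b + 1) := by
  induction k generalizing s with
  | zero => simpa [forTuples] using h _ s
  | succ k ih =>
    have h1 : ∀ a s, (forTuples l k (fun I => body (Fin.cons a I)) s).time
        ≤ (l.length + 1) ^ k * (b + 1) - 1 := fun a s =>
      Nat.le_sub_one_of_lt (ih _ (fun I s => h _ s) s)
    have h2 := forEach_time_le l _ _ h1 s
    have h3 : 1 ≤ (l.length + 1) ^ k * (b + 1) := Nat.mul_pos (by positivity) (by positivity)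
    rw [Nat.sub_add_cancel h3] at h2
    rw [forTuples, pow_succ']
    calc _ ≤ l.length * ((l.length + 1) ^ k * (b + 1)) + (l.length + 1) ^ k * (b + 1) := by
          gcongr
      _ = _ := by ring

lemma mem_foldl_iff {A β : Type*} (step : List β → A → List β) (P : A → β → Prop)
    (h : ∀ s a x, x ∈ step s a ↔ x ∈ s ∨ P a x) (l : List A) (s : List β) (x : β) :
    x ∈ l.foldl step s ↔ x ∈ s ∨ ∃ a ∈ l, P a x := by
  induction l generalizing s with
  | nil => simp
  | cons a l ih => simp [ih, h, or_assoc]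

lemma length_foldl {A β : Type*} (step : List β → A → List β) (b : ℕ)
    (h : ∀ s a, (step s a).length = s.length + b) (l : List A) (s : List β) :
    (l.foldl step s).length = s.length + l.length * b := by
  induction l generalizing s with
  | nil => simp
  | cons a l ih => simp only [List.foldl_cons, ih, h, List.length_cons]; ring

lemma foldl_finRange_add {M : Type*} [AddCommMonoid M] {k : ℕ} (g : Fin k → M) :
    (List.finRange k).foldl (fun acc i => acc + g i) 0 = ∑ i, g i := by
  rw [Fin.sum_univ_def, List.sum_eq_foldl, List.foldl_map]

/-- The exhaustive search: folding a list with a comparison of the costs gives a minimizer. -/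
lemma exists_foldl_argmin {A β : Type*} (g : A → β) (cost : A → ℕ) (l : List A) :
    ∀ s : Option (β × ℕ), (s = none → l ≠ []) → ∃ v c,
      l.foldl (fun best a => match best with
        | none => some (g a, cost a)
        | some (v, c') => if cost a < c' then some (g a, cost a) else some (v, c')) s
        = some (v, c) ∧
      (s = some (v, c) ∨ ∃ a ∈ l, v = g a ∧ c = cost a) ∧
      (∀ v' c', s = some (v', c') → c ≤ c') ∧ ∀ a ∈ l, c ≤ cost a := by
  induction l with
  | nil =>
    rintro (_ | ⟨v, c⟩) hs
    · exact absurd rfl (hs rfl)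
    · exact ⟨v, c, rfl, .inl rfl, by simp, by simp⟩
  | cons a l ih =>
    rintro (_ | ⟨v₀, c₀⟩) hs
    · obtain ⟨v, c, h1, h2, h3, h4⟩ := ih (some (g a, cost a)) (by simp)
      refine ⟨v, c, h1, .inr ?_, by simp, ?_⟩
      · rcases h2 with h2 | ⟨a', ha', h2⟩
        · simp only [Option.some.injEq, Prod.mk.injEq] at h2
          exact ⟨a, by simp, h2.1.symm, h2.2.symm⟩
        · exact ⟨a', by simp [ha'], h2⟩
      · intro a' ha'
        rcases List.mem_cons.1 ha' with rfl | ha'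
        · exact h3 _ _ rfl
        · exact h4 a' ha'
    · simp only [List.foldl_cons]
      split_ifs with hlt
      · obtain ⟨v, c, h1, h2, h3, h4⟩ := ih (some (g a, cost a)) (by simp)
        have h5 := h3 _ _ rfl
        refine ⟨v, c, h1, .inr ?_, ?_, ?_⟩
        · rcases h2 with h2 | ⟨a', ha', h2⟩
          · simp only [Option.some.injEq, Prod.mk.injEq] at h2
            exact ⟨a, by simp, h2.1.symm, h2.2.symm⟩
          · exact ⟨a', by simp [ha'], h2⟩
        · intro v' c' h
          simp only [Option.some.injEq, Prod.mk.injEq] at h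
          omega
        · intro a' ha'
          rcases List.mem_cons.1 ha' with rfl | ha'
          · exact h5
          · exact h4 a' ha'
      · obtain ⟨v, c, h1, h2, h3, h4⟩ := ih (some (v₀, c₀)) (by simp)
        have h5 := h3 _ _ rfl
        refine ⟨v, c, h1, ?_, h3, ?_⟩
        · exact h2.imp id fun ⟨a', ha', h⟩ => ⟨a', by simp [ha'], h⟩
        · intro a' ha'
          rcases List.mem_cons.1 ha' with rfl | ha'
          · omega
          · exact h4 a' ha'

section Program

variable {X : Type u} {B : Type v} {n : ℕ} (S : Fin n → X × ℤˣ) (W : Learner X B) (m₀ : ℕ)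
  (θ δ δ₀ : ℝ) (seed : CallIndex n m₀ θ δ δ₀ → B)

lemma collectHyps_val_eq : (collectHyps S W m₀ θ δ δ₀ seed).val
    = (List.finRange (numRounds n θ)).foldl (fun s r =>
        (tupleList (List.finRange (n / 2)) m₀).foldl (fun s I =>
          (List.finRange (numRepeats n θ δ δ₀)).foldl (fun s m =>
            W m₀ (fun j => firstHalf S (I j)) (seed (r, I, m)) :: s) s) s) [] := by
  simp only [collectHyps, forEach_val, forTuples_val, Counted.bind, charge, callLearner]

lemma mem_collectHyps_val (h : X → ℤˣ) :
    h ∈ (collectHyps S W m₀ θ δ δ₀ seed).val ↔ h ∈ hypPool S W m₀ θ δ δ₀ seed := by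
  rw [collectHyps_val_eq, mem_foldl_iff _ _ (fun s r x => mem_foldl_iff _ _
    (fun s I x => mem_foldl_iff _ _ (fun s m x => by rw [List.mem_cons, or_comm]) _ s x) _ s x)]
  simp [hypPool, mem_tupleList]

lemma length_collectHyps_val : (collectHyps S W m₀ θ δ δ₀ seed).val.length
    = numRounds n θ * ((n / 2) ^ m₀ * numRepeats n θ δ δ₀) := by
  rw [collectHyps_val_eq, length_foldl _ _ (fun s r => length_foldl _ _
    (fun s I => length_foldl _ 1 (fun s m => List.length_cons) _ s) _ s)]
  simp [length_tupleList]

lemma collectHyps_calls : (collectHyps S W m₀ θ δ δ₀ seed).calls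
    = numRounds n θ * ((n / 2) ^ m₀ * numRepeats n θ δ δ₀) := by
  rw [collectHyps, forEach_calls _ _ _ fun r s => forTuples_calls _ _ _ _ (fun I s => ?_) s]
  · simp only [List.length_finRange]
    rfl
  · simp only [Counted.bind, charge, zero_add]
    rw [forEach_calls _ _ 1 fun m s => ?_]
    · simp
    · simp [callLearner]

lemma collectHyps_time_le : (collectHyps S W m₀ θ δ δ₀ seed).time
    ≤ numRounds n θ * ((n / 2 + 1) ^ m₀ * (m₀ + numRepeats n θ δ δ₀ * 4 + 1)) := by
  have h1 : ∀ r (I : Fin m₀ → Fin (n / 2)) (s : List (X → ℤˣ)),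
      ((charge m₀ fun j => firstHalf S (I j)).bind fun S' =>
        forEach (List.finRange (numRepeats n θ δ δ₀)) (fun m pool =>
          (charge 1 (seed (r, I, m))).bind fun b =>
            (callLearner W m₀ S' b).bind fun h => charge 1 (h :: pool)) s).time
      ≤ m₀ + numRepeats n θ δ δ₀ * 4 := by
    intro r I s
    simp only [Counted.bind, charge]
    refine Nat.add_le_add_left ((forEach_time_le _ _ 3 (fun m s => ?_) _).trans ?_) _
    · simp [callLearner]
    · simp
  have h2 := fun r s => forTuples_time_le (List.finRange (n / 2)) m₀ _ _ (h1 r) s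
  have h3 := forEach_time_le (List.finRange (numRounds n θ)) _ _
    (fun r s => Nat.le_sub_one_of_lt (h2 r s)) ([] : List (X → ℤˣ))
  rw [Nat.sub_add_cancel (Nat.mul_pos (by positivity) (by positivity))] at h3
  simpa [collectHyps] using h3

end Program

lemma sumVotes_val {X : Type*} (evalTime : ℕ) {T : ℕ} (f : Fin T → X → ℤˣ) (x : X) :
    (sumVotes evalTime f x).val = ∑ t, (f t x : ℤ) := by
  rw [← foldl_finRange_add, sumVotes, forEach_val]
  rfl

lemma countErrors_val {X : Type*} (evalTime : ℕ) {T k : ℕ} (f : Fin T → X → ℤˣ)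
    (S : Fin k → X × ℤˣ) : ((countErrors evalTime f S).val : ℝ) / k = empErr S (signAvg f) := by
  classical
  have h1 : ∀ x, sgn (((∑ t, (f t x : ℤ) : ℤ) : ℝ) / T) = signAvg f x := by
    intro x
    simp only [signAvg, labelVal]
    congr 1
    push_cast
    ring
  have h2 : (countErrors evalTime f S).val
      = (Finset.univ.filter fun i => signAvg f (S i).1 ≠ (S i).2).card := by
    rw [Finset.card_filter, ← foldl_finRange_add, countErrors, forEach_val]
    congr 1
    funext acc i
    simp only [Counted.bind, charge, sumVotes_val, h1]
    by_cases h : signAvg f (S i).1 = (S i).2 <;> simp [h]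
  rw [h2, empErr]

lemma countErrors_calls {X : Type*} (evalTime : ℕ) {T k : ℕ} (f : Fin T → X → ℤˣ)
    (S : Fin k → X × ℤˣ) : (countErrors evalTime f S).calls = 0 := by
  rw [countErrors, forEach_calls _ _ 0 fun i s => ?_, mul_zero]
  simp only [Counted.bind, charge, add_zero]
  rw [sumVotes, forEach_calls _ _ 0 fun i s => rfl, mul_zero]

lemma countErrors_time_le {X : Type*} (evalTime : ℕ) {T k : ℕ} (f : Fin T → X → ℤˣ)
    (S : Fin k → X × ℤˣ) :
    (countErrors evalTime f S).time ≤ k * (T * (evalTime + 2) + 4) := by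
  have h1 : ∀ x, (sumVotes evalTime f x).time ≤ T * (evalTime + 2) := by
    intro x
    have h := forEach_time_le (List.finRange T) (fun t acc =>
      (charge evalTime (f t x)).bind fun y => charge 1 (acc + (y : ℤ))) (evalTime + 1)
      (fun t s => by simp [Counted.bind, charge]) 0
    rw [List.length_finRange] at h
    exact h
  have h2 := forEach_time_le (List.finRange k) (fun i acc =>
    (sumVotes evalTime f (S i).1).bind fun z =>
      charge 3 (if sgn ((z : ℝ) / T) = (S i).2 then acc else acc + 1)) (T * (evalTime + 2) + 3)
      (fun i s => by simpa [Counted.bind, charge] using h1 _) 0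
  simpa [countErrors] using h2

/-- The exhaustive search returns an empirical risk minimizer. -/
lemma exists_searchBest_val {X : Type*} (evalTime T : ℕ) {k : ℕ} (S : Fin k → X × ℤˣ)
    {pool : List (X → ℤˣ)} (hpool : pool ≠ []) :
    ∃ v c, (searchBest evalTime T S pool).val = some (v, c) ∧
      v ∈ ermSet S (signAvgClass T {h | h ∈ pool}) := by
  have hne : tupleList pool T ≠ [] := by
    obtain ⟨h, hh⟩ := List.exists_mem_of_ne_nil pool hpool
    exact List.ne_nil_of_mem (mem_tupleList.2 fun _ : Fin T => hh)
  obtain ⟨v, c, h1, h2, -, h4⟩ := exists_foldl_argmin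
    (fun f : Fin T → X → ℤˣ => signAvg f) (fun f => (countErrors evalTime f S).val)
    (tupleList pool T) none (fun _ => hne)
  refine ⟨v, c, ?_, ?_⟩
  · rw [← h1, searchBest, forTuples_val]
    congr 1
    funext s f
    rcases s with _ | ⟨v', c'⟩ <;> rfl
  · obtain ⟨f, hf, rfl, rfl⟩ := h2.resolve_left (by simp)
    refine ⟨⟨f, mem_tupleList.1 hf, rfl⟩, ?_⟩
    rintro _ ⟨f', hf', rfl⟩
    rw [← countErrors_val evalTime, ← countErrors_val evalTime]
    gcongr
    exact h4 f' (mem_tupleList.2 hf')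

lemma searchBest_calls {X : Type*} (evalTime T : ℕ) {k : ℕ} (S : Fin k → X × ℤˣ)
    (pool : List (X → ℤˣ)) : (searchBest evalTime T S pool).calls = 0 := by
  rw [searchBest, forTuples_calls _ _ _ 0 fun f s => ?_, mul_zero]
  simp [Counted.bind, charge, countErrors_calls]

lemma searchBest_time_le {X : Type*} (evalTime T : ℕ) {k : ℕ} (S : Fin k → X × ℤˣ)
    (pool : List (X → ℤˣ)) : (searchBest evalTime T S pool).time
      ≤ (pool.length + 1) ^ T * (k * (T * (evalTime + 2) + 4) + T + 3) := by
  have h := forTuples_time_le pool T (fun f best =>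
    (countErrors evalTime f S).bind fun c =>
      charge (T + 2) (match best with
        | none => some (signAvg f, c)
        | some (v, c') => if c < c' then some (signAvg f, c) else some (v, c')))
    (k * (T * (evalTime + 2) + 4) + (T + 2))
    (fun f s => by
      simp only [Counted.bind, charge]
      exact Nat.add_le_add_right (countErrors_time_le evalTime f S) _) none
  exact (Nat.le_succ _).trans h

section Program

variable {X : Type u} {B : Type v} (evalTime : ℕ) {n : ℕ} (S : Fin n → X × ℤˣ) (W : Learner X B)
  (m₀ : ℕ) (θ δ δ₀ : ℝ) (dstar : ℕ) (seed : CallIndex n m₀ θ δ δ₀ → B)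

lemma exists_agnosticBoost_val (hn : 2 ≤ n) (hθ : 0 < θ) (hδ : δ ∈ Set.Ioo (0 : ℝ) 1)
    (hδ₀ : δ₀ ∈ Set.Ioo (0 : ℝ) 1) :
    ∃ v ∈ boostOutputs S W m₀ θ δ δ₀ dstar seed,
      (agnosticBoost evalTime S W m₀ θ δ δ₀ dstar seed).val = some v := by
  have hset : {h | h ∈ (collectHyps S W m₀ θ δ δ₀ seed).val} = hypPool S W m₀ θ δ δ₀ seed :=
    Set.ext fun h => mem_collectHyps_val S W m₀ θ δ δ₀ seed h
  have hpool : (collectHyps S W m₀ θ δ δ₀ seed).val ≠ [] := by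
    rw [← List.length_pos_iff, length_collectHyps_val]
    have h1 := one_le_numRounds hn hθ
    have h2 := one_le_numRepeats hn hθ hδ hδ₀
    have h3 : 0 < n / 2 := by omega
    positivity
  obtain ⟨v, c, h1, h2⟩ := exists_searchBest_val evalTime (numCombined n θ dstar) (secondHalf S)
    hpool
  rw [hset] at h2
  refine ⟨v, h2, ?_⟩
  simp only [agnosticBoost, Counted.bind, charge, h1, Option.map_some]

lemma agnosticBoost_calls : (agnosticBoost evalTime S W m₀ θ δ δ₀ dstar seed).calls
    = numRounds n θ * ((n / 2) ^ m₀ * numRepeats n θ δ δ₀) := by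
  simp only [agnosticBoost, Counted.bind, charge, searchBest_calls, collectHyps_calls, zero_add,
    add_zero]

lemma agnosticBoost_time_le : (agnosticBoost evalTime S W m₀ θ δ δ₀ dstar seed).time
    ≤ n + 4 + numRounds n θ * ((n / 2 + 1) ^ m₀ * (m₀ + numRepeats n θ δ δ₀ * 4 + 1))
      + (numRounds n θ * ((n / 2) ^ m₀ * numRepeats n θ δ δ₀) + 1) ^ numCombined n θ dstar
        * (n / 2 * (numCombined n θ dstar * (evalTime + 2) + 4) + numCombined n θ dstar + 3) := by
  have h1 := collectHyps_time_le S W m₀ θ δ δ₀ seed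
  have h2 := searchBest_time_le evalTime (numCombined n θ dstar) (secondHalf S)
    (collectHyps S W m₀ θ δ δ₀ seed).val
  rw [length_collectHyps_val] at h2
  simp only [agnosticBoost, Counted.bind, charge]
  omega

end Program

/-! ### The cost in the regime of large samples -/

/-- The running time in powers of `n`, if `R`, `M`, `T` are bounded by a power of `n`. -/
lemma time_le_pow {n m₀ T R M E a : ℕ} (hn : 2 ≤ n) (hm₀ : 1 ≤ m₀) (hT : 1 ≤ T) (hE : 1 ≤ E)
    (hRa : R ≤ n ^ a) (hMa : M ≤ n ^ a) (hTa : T ≤ n ^ a) :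
    n + 4 + R * ((n / 2 + 1) ^ m₀ * (m₀ + M * 4 + 1))
      + (R * ((n / 2) ^ m₀ * M) + 1) ^ T * (n / 2 * (T * (E + 2) + 4) + T + 3)
      ≤ E * n ^ (m₀ * T * (4 * a + 11)) := by
  have hn0 : 0 < n := by omega
  have hpow : ∀ {i j : ℕ}, i ≤ j → n ^ i ≤ n ^ j := fun h => Nat.pow_le_pow_right hn0 h
  have htwo : ∀ k, 2 ^ k ≤ n ^ k := fun k => Nat.pow_le_pow_left hn k
  have hhalf : n / 2 + 1 ≤ n := by omega
  have hhalf' : n / 2 ≤ n := by omega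
  have hone : ∀ k, 1 ≤ n ^ k := fun k => Nat.one_le_pow _ _ hn0
  have hm : m₀ + 1 ≤ n ^ m₀ := (Nat.lt_pow_self (by norm_num : 1 < 2)).trans_le (htwo m₀)
  set e := (2 * a + m₀ + 1) * T + 2 * m₀ + 2 * a + 5 with he
  have h1 : n + 4 ≤ n ^ e := by
    have : n + 4 ≤ n ^ 3 := by nlinarith [pow_succ n 2, sq n]
    exact this.trans (hpow (by omega))
  have h2 : R * ((n / 2 + 1) ^ m₀ * (m₀ + M * 4 + 1)) ≤ n ^ e := by
    have h3 : m₀ + M * 4 + 1 ≤ n ^ (m₀ + a + 3) := by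
      have h4 : M * 4 ≤ n ^ (a + 2) := by
        rw [pow_add]; exact Nat.mul_le_mul hMa (htwo 2)
      have h5 : n ^ m₀ ≤ n ^ (m₀ + a + 2) := hpow (by omega)
      have h6 : n ^ (a + 2) ≤ n ^ (m₀ + a + 2) := hpow (by omega)
      have h7 : n ^ (m₀ + a + 2) * 2 ≤ n ^ (m₀ + a + 2) * n := Nat.mul_le_mul_left _ hn
      rw [show m₀ + a + 3 = m₀ + a + 2 + 1 by omega, pow_succ]
      omega
    calc R * ((n / 2 + 1) ^ m₀ * (m₀ + M * 4 + 1)) ≤ n ^ a * (n ^ m₀ * n ^ (m₀ + a + 3)) := by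
          gcongr
      _ = n ^ (a + (m₀ + (m₀ + a + 3))) := by ring
      _ ≤ n ^ e := hpow (by omega)
  have h8 : (R * ((n / 2) ^ m₀ * M) + 1) ^ T * (n / 2 * (T * (E + 2) + 4) + T + 3)
      ≤ E * n ^ e := by
    have h9 : R * ((n / 2) ^ m₀ * M) + 1 ≤ n ^ (2 * a + m₀ + 1) := by
      have h10 : R * ((n / 2) ^ m₀ * M) ≤ n ^ (2 * a + m₀) := by
        calc R * ((n / 2) ^ m₀ * M) ≤ n ^ a * (n ^ m₀ * n ^ a) := by gcongr
          _ = n ^ (2 * a + m₀) := by ring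
      have h11 : n ^ (2 * a + m₀) * 2 ≤ n ^ (2 * a + m₀) * n := Nat.mul_le_mul_left _ hn
      have h12 := hone (2 * a + m₀)
      rw [pow_succ]
      omega
    have h13 : n / 2 * (T * (E + 2) + 4) + T + 3 ≤ E * n ^ (a + 5) := by
      have h14 : 1 ≤ T * E := Nat.mul_pos hT hE
      have h15 : T ≤ T * E := Nat.le_mul_of_pos_right _ hE
      have h16 : T * (E + 2) + 4 ≤ 7 * (T * E) := by linarith [mul_add T E 2]
      have h17 : n / 2 * (T * (E + 2) + 4) ≤ n * (7 * (T * E)) := by gcongr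
      have h18 : 1 * (T * E) ≤ n * (T * E) := by gcongr; omega
      calc n / 2 * (T * (E + 2) + 4) + T + 3 ≤ 2 ^ 4 * (n * (T * E)) := by linarith
        _ ≤ n ^ 4 * (n * (n ^ a * E)) := by gcongr
        _ = E * n ^ (a + 5) := by rw [pow_add]; ring
    calc _ ≤ (n ^ (2 * a + m₀ + 1)) ^ T * (E * n ^ (a + 5)) := by gcongr
      _ = E * n ^ ((2 * a + m₀ + 1) * T + (a + 5)) := by
        rw [pow_add n ((2 * a + m₀ + 1) * T), pow_mul]; ring
      _ ≤ E * n ^ e := by gcongr; omega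
  have h19 : e + 2 ≤ m₀ * T * (4 * a + 11) := by
    have h20 : 1 ≤ m₀ * T := Nat.mul_pos hm₀ hT
    have h21 : m₀ ≤ m₀ * T := Nat.le_mul_of_pos_right _ hT
    have h22 : T ≤ m₀ * T := Nat.le_mul_of_pos_left _ hm₀
    rw [he]
    nlinarith
  have h23 : n ^ e ≤ E * n ^ e := Nat.le_mul_of_pos_left _ hE
  calc _ ≤ E * n ^ e * 2 ^ 2 := by omega
    _ ≤ E * n ^ e * n ^ 2 := by gcongr
    _ = E * n ^ (e + 2) := by rw [pow_add]; ring
    _ ≤ E * n ^ (m₀ * T * (4 * a + 11)) := by gcongr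

lemma numCombined_le_numRounds (n : ℕ) (θ : ℝ) (dstar : ℕ) :
    numCombined n θ dstar ≤ numRounds n θ :=
  Nat.ceil_le.2 (min_le_left _ _)

lemma half_le_log_two : (1 / 2 : ℝ) ≤ Real.log 2 := by
  have := Real.log_two_gt_d9; linarith

/-- If the sample is large compared to `T`, then the number of rounds is quadratic in `n`, as
`T ≥ ln 2 / θ ^ 2`. -/
lemma numRounds_le {n : ℕ} (hn : 2 ≤ n) {θ c : ℝ} (hθ : 0 < θ) (hc : 0 < c) {dstar : ℕ}
    (h : c * numCombined n θ dstar ≤ n) : (numRounds n θ : ℝ) ≤ (2 / c + 1) * n ^ 2 := by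
  have hn1 : (2 : ℝ) ≤ n := by exact_mod_cast hn
  have hlog : Real.log 2 ≤ Real.log n := Real.log_le_log (by norm_num) hn1
  have hlog2 := half_le_log_two
  have h1 : (1 / 2) / θ ^ 2 ≤ numCombined n θ dstar := by
    refine le_trans (le_min ?_ ?_) (Nat.le_ceil _)
    · refine le_trans ?_ (Nat.le_ceil _)
      gcongr; linarith
    · rw [← mul_div_assoc]
      gcongr
      have : (0 : ℝ) ≤ dstar := by positivity
      linarith
  have h2 : 1 / θ ^ 2 ≤ 2 / c * n := by
    have h3 : 1 / θ ^ 2 = 2 * ((1 / 2) / θ ^ 2) := by ring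
    have h4 : (numCombined n θ dstar : ℝ) ≤ n / c := by rw [le_div_iff₀' hc]; exact h
    rw [h3, div_mul_eq_mul_div, mul_div_assoc]
    linarith
  have h5 : Real.log n ≤ n := (Real.log_le_sub_one_of_pos (by linarith)).trans (by linarith)
  have h6 : Real.log n / θ ^ 2 ≤ n * (2 / c * n) := by
    rw [div_eq_mul_one_div]
    exact mul_le_mul h5 h2 (by positivity) (by linarith)
  have h7 := (Nat.ceil_lt_add_one (show 0 ≤ Real.log n / θ ^ 2 from
    div_nonneg (by linarith) (by positivity))).le
  rw [numRounds]
  nlinarith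

/-- If moreover the sample is large compared to `ln (1 / δ)`, then the number of repetitions is
linear in `n`. -/
lemma numRepeats_le {n : ℕ} (hn : 2 ≤ n) {θ c δ δ₀ : ℝ} (hθ : 0 < θ) (hc : 0 < c)
    (hδ : δ ∈ Set.Ioo (0 : ℝ) 1) (hδ₀ : δ₀ ∈ Set.Ioo (0 : ℝ) 1) {dstar : ℕ}
    (h : c * numCombined n θ dstar ≤ n) (h' : c * Real.log (1 / δ) ≤ n) :
    (numRepeats n θ δ δ₀ : ℝ) ≤ ((6 + 3 / c) / Real.log (1 / δ₀) + 1) * n := by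
  have hn1 : (2 : ℝ) ≤ n := by exact_mod_cast hn
  have hR := numRounds_le hn hθ hc h
  have hR0 : (0 : ℝ) < numRounds n θ := by exact_mod_cast one_le_numRounds hn hθ
  have hl := log_inv_pos hδ₀
  have h1 : Real.log (5 * numRounds n θ / δ) ≤ (6 + 3 / c) * n := by
    rw [show 5 * (numRounds n θ : ℝ) / δ = 5 * (numRounds n θ * (1 / δ)) by ring,
      Real.log_mul (by norm_num) (by have := hδ.1; positivity),
      Real.log_mul hR0.ne' (by have := hδ.1; positivity)]
    have h2 : Real.log 5 ≤ 4 := (Real.log_le_sub_one_of_pos (by norm_num)).trans (by norm_num)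
    have h3 : Real.log (numRounds n θ) ≤ 2 / c + 2 * n := by
      calc Real.log (numRounds n θ) ≤ Real.log ((2 / c + 1) * n ^ 2) := Real.log_le_log hR0 hR
        _ = Real.log (2 / c + 1) + 2 * Real.log n := by
          rw [Real.log_mul (by positivity) (by positivity), Real.log_pow]; norm_num
        _ ≤ 2 / c + 2 * n := by
          have h4 := Real.log_le_sub_one_of_pos (show 0 < 2 / c + 1 by positivity)
          have h5 := Real.log_le_sub_one_of_pos (show (0 : ℝ) < n by linarith)
          linarith
    have h6 : Real.log (1 / δ) ≤ 1 / c * n := by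
      rw [div_mul_eq_mul_div, one_mul, le_div_iff₀' hc]; exact h'
    have h7 : 2 / c ≤ 2 / c * n := le_mul_of_one_le_right (by positivity) (by linarith)
    have h8 : (6 + 3 / c) * n = 6 * n + 2 / c * n + 1 / c * n := by ring
    linarith
  have h9 := (Nat.ceil_lt_add_one (show 0 ≤ Real.log (5 * numRounds n θ / δ) / Real.log (1 / δ₀)
    from (div_pos (log_five_mul_numRounds_div_pos hn hθ hδ) hl).le)).le
  have h10 : Real.log (5 * numRounds n θ / δ) / Real.log (1 / δ₀)
      ≤ (6 + 3 / c) / Real.log (1 / δ₀) * n := by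
    rw [div_mul_eq_mul_div]; gcongr
  rw [numRepeats]
  linarith

lemma numCombined_le {n : ℕ} (hn : 2 ≤ n) {θ : ℝ} (hθ : 0 < θ) (hθ1 : θ ≤ 1 / 2) (dstar : ℕ) :
    (numCombined n θ dstar : ℝ)
      ≤ 405601 * (min ((max dstar 1 : ℕ) : ℝ) (Real.log n) / θ ^ 2) := by
  have hn1 : (2 : ℝ) ≤ n := by exact_mod_cast hn
  have hlog : 1 / 2 ≤ Real.log n := half_le_log_two.trans (Real.log_le_log (by norm_num) hn1)
  have hD1 : (1 : ℝ) ≤ (max dstar 1 : ℕ) := by exact_mod_cast le_max_right _ _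
  have hD2 : (dstar : ℝ) ≤ (max dstar 1 : ℕ) := by exact_mod_cast le_max_left _ _
  set D : ℝ := ((max dstar 1 : ℕ) : ℝ)
  set q := min D (Real.log n) with hq
  have hq0 : 1 / 2 ≤ q := le_min (by linarith) hlog
  -- `260 ^ 2 * (4 * D + 2) ≤ 405600 * D` for `D ≥ 1`
  have h1 : min (Real.log n / θ ^ 2) (260 ^ 2 * (4 * dstar + 2) / θ ^ 2)
      ≤ 405600 * (q / θ ^ 2) := by
    rw [← mul_div_assoc]
    rcases min_cases D (Real.log n) with ⟨h, -⟩ | ⟨h, -⟩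
    · refine (min_le_right _ _).trans ?_
      refine div_le_div_of_nonneg_right ?_ (by positivity)
      rw [hq, h]; linarith
    · refine (min_le_left _ _).trans ?_
      refine div_le_div_of_nonneg_right ?_ (by positivity)
      rw [hq, h]; linarith
  have h2 : 1 ≤ q / θ ^ 2 := by
    rw [le_div_iff₀ (by positivity)]; nlinarith
  rw [← numCombined_eq]
  have h3 := (Nat.ceil_lt_add_one (show 0 ≤ min (Real.log n / θ ^ 2)
    (260 ^ 2 * (4 * (dstar : ℝ) + 2) / θ ^ 2) from
    le_min (div_nonneg (by linarith) (by positivity)) (by positivity))).le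
  linarith

/-- The bounds for the number of calls and the running time, with constants that depend only on
`δ₀` and `c`. -/
theorem exists_cost_bounds {δ₀ : ℝ} (hδ₀ : δ₀ ∈ Set.Ioo (0 : ℝ) 1) {c : ℝ} (hc : 0 < c) :
    ∃ C K : ℝ, 0 < C ∧ 0 < K ∧
      ∀ {X : Type u} {B : Type v} (evalTime : ℕ) {n : ℕ} (S : Fin n → X × ℤˣ) (W : Learner X B)
        (m₀ : ℕ) (θ δ : ℝ) (d dstar : ℕ) (seed : CallIndex n m₀ θ δ δ₀ → B),
        2 ≤ n → 0 < θ → θ ≤ 1 / 2 → 1 ≤ m₀ → 1 ≤ evalTime → δ ∈ Set.Ioo (0 : ℝ) 1 →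
        c * max ((max d 1 : ℕ) * numCombined n θ dstar : ℝ) (Real.log (1 / δ)) ≤ n →
        ((agnosticBoost evalTime S W m₀ θ δ δ₀ dstar seed).calls : ℝ) ≤ C * (n : ℝ) ^ (m₀ + 3) ∧
        ((agnosticBoost evalTime S W m₀ θ δ δ₀ dstar seed).time : ℝ)
          ≤ evalTime * (n : ℝ) ^
            (K * (m₀ * min ((max dstar 1 : ℕ) : ℝ) (Real.log n) / θ ^ 2)) := by
  have hl := log_inv_pos hδ₀
  set C₁ : ℝ := 2 / c + 1 with hC₁
  set C₂ : ℝ := (6 + 3 / c) / Real.log (1 / δ₀) + 1 with hC₂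
  have hC₁0 : 0 < C₁ := by positivity
  have hC₂0 : 0 < C₂ := by positivity
  -- as `n ≥ 2`, the constants are at most `n ^ k`
  obtain ⟨k, hk⟩ := pow_unbounded_of_one_lt (max C₁ C₂) (show (1 : ℝ) < 2 by norm_num)
  set a := k + 2
  refine ⟨C₁ * C₂, (4 * a + 11) * 405601, by positivity, by positivity, ?_⟩
  intro X B evalTime n S W m₀ θ δ d dstar seed hn hθ hθ1 hm₀ hE hδ hreg
  have hn1 : (2 : ℝ) ≤ n := by exact_mod_cast hn
  have hn0 : (0 : ℝ) < n := by linarith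
  have hT : c * numCombined n θ dstar ≤ n := by
    refine le_trans ?_ hreg
    gcongr
    refine le_trans ?_ (le_max_left _ _)
    exact le_mul_of_one_le_left (by positivity) (by exact_mod_cast le_max_right _ _)
  have hlogδ : c * Real.log (1 / δ) ≤ n := by
    refine le_trans ?_ hreg
    gcongr
    exact le_max_right _ _
  have hR := numRounds_le hn hθ hc hT
  have hM := numRepeats_le hn hθ hc hδ hδ₀ hT hlogδ
  have hk1 : C₁ ≤ n ^ k := (le_max_left _ _).trans (hk.le.trans (by gcongr))
  have hk2 : C₂ ≤ n ^ k := (le_max_right _ _).trans (hk.le.trans (by gcongr))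
  constructor
  · rw [agnosticBoost_calls]
    push_cast
    have h1 : ((n / 2 : ℕ) : ℝ) ≤ n := by exact_mod_cast Nat.div_le_self n 2
    calc (numRounds n θ : ℝ) * (((n / 2 : ℕ) : ℝ) ^ m₀ * numRepeats n θ δ δ₀)
        ≤ (C₁ * n ^ 2) * ((n : ℝ) ^ m₀ * (C₂ * n)) := by gcongr
      _ = C₁ * C₂ * (n : ℝ) ^ (m₀ + 3) := by ring
  · have hRa : numRounds n θ ≤ n ^ a := by
      have : (numRounds n θ : ℝ) ≤ (n : ℝ) ^ a := by
        rw [pow_add]; exact hR.trans (by gcongr)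
      exact_mod_cast this
    have hMa : numRepeats n θ δ δ₀ ≤ n ^ a := by
      have : (numRepeats n θ δ δ₀ : ℝ) ≤ (n : ℝ) ^ a := by
        rw [pow_add]; exact hM.trans (by gcongr; nlinarith)
      exact_mod_cast this
    have hTa : numCombined n θ dstar ≤ n ^ a := (numCombined_le_numRounds n θ dstar).trans hRa
    have h1 := (agnosticBoost_time_le evalTime S W m₀ θ δ δ₀ dstar seed).trans
      (time_le_pow hn hm₀ (one_le_numCombined hn hθ dstar) hE hRa hMa hTa)
    have h2 := numCombined_le hn hθ hθ1 dstar
    calc ((agnosticBoost evalTime S W m₀ θ δ δ₀ dstar seed).time : ℝ)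
        ≤ evalTime * (n : ℝ) ^ (m₀ * numCombined n θ dstar * (4 * a + 11)) := by
          exact_mod_cast h1
      _ ≤ _ := by
          rw [← Real.rpow_natCast]
          gcongr
          · linarith
          · push_cast
            calc (m₀ : ℝ) * numCombined n θ dstar * (4 * a + 11)
                ≤ m₀ * (405601 * (min ((max dstar 1 : ℕ) : ℝ) (Real.log n) / θ ^ 2))
                  * (4 * a + 11) := by gcongr
              _ = _ := by push_cast; ring

end

/-- The constants `C`, `K` hidden in the two `O(·)` depend only on the failure probability `δ₀` of
the weak learner and on the constant `c` in the regime `n = Ω(max {d T, ln (1/δ)})`. -/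
theorem mainTheorem1 (δ₀ : ℝ) (hδ₀ : δ₀ ∈ Set.Ioo (0 : ℝ) 1) (c : ℝ) (hc : 0 < c) :
    ∃ C K : ℝ, 0 < C ∧ 0 < K ∧
      ∀ (X : Type u) [Countable X] [MeasurableSpace X] [MeasurableSingletonClass X]
        (B : Type v) [MeasurableSpace B] (U : Measure B) [IsProbabilityMeasure U]
        (F H : Set (X → ℤˣ)) (γ₀ ε₀ : ℝ) (m₀ d dstar : ℕ) (W : Learner X B)
        (D : Measure (X × ℤˣ)) [IsProbabilityMeasure D] (δ : ℝ) (n : ℕ) (θ : ℝ) (T : ℕ)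
        (d' errStar : ℝ) (evalTime : ℕ),
        F.Nonempty →
        γ₀ ∈ Set.Ioo (0 : ℝ) 1 → ε₀ ∈ Set.Ioo (0 : ℝ) 1 → ε₀ < γ₀ → 1 ≤ m₀ →
        VCdim H = d → VCdim (dualClass H) = dstar →
        IsAgnosticWeakLearner F H γ₀ ε₀ δ₀ m₀ U W →
        δ ∈ Set.Ioo (0 : ℝ) 1 → 1 ≤ n → Even n → 1 ≤ evalTime →
        θ = (γ₀ - ε₀) / 2 →
        T = ⌈min (Real.log n / θ ^ 2) (260 ^ 2 * (4 * dstar + 2) / θ ^ 2)⌉₊ →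
        d' = 4 * T * d * Real.log (4 * Real.exp 1 * T) →
        errStar = ⨅ f : F, err D f →
        -- error bound, for every minimizer that the algorithm may return
        1 - δ ≤ ((Measure.pi fun _ : Fin n => D).prod
              (Measure.pi fun _ : CallIndex n m₀ θ δ δ₀ => U)).real
            {p | ∀ v ∈ boostOutputs p.1 W m₀ θ δ δ₀ dstar p.2,
              err D v ≤ errStar
                + 10 * √(errStar *
                    ((d' * Ln (10 * Real.exp 1 * n / d') + Real.log (5 / δ)) / n))
                + 182 * ((d' * Ln (10 * Real.exp 1 * n / d') + 4 * Real.log (5 / δ)) / n)} ∧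
        ∀ (S : Fin n → X × ℤˣ) (seed : CallIndex n m₀ θ δ δ₀ → B),
          -- the run ends with such a minimizer
          (∃ v ∈ boostOutputs S W m₀ θ δ δ₀ dstar seed,
            (agnosticBoost evalTime S W m₀ θ δ δ₀ dstar seed).val = some v) ∧
          -- number of weak learner calls and running time in the non-vacuous regime
          (c * max ((max d 1 : ℕ) * T : ℝ) (Real.log (1 / δ)) ≤ n →
            ((agnosticBoost evalTime S W m₀ θ δ δ₀ dstar seed).calls : ℝ)
                ≤ C * (n : ℝ) ^ (m₀ + 3) ∧
            ((agnosticBoost evalTime S W m₀ θ δ δ₀ dstar seed).time : ℝ)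
                ≤ evalTime * (n : ℝ) ^
                  (K * (m₀ * min ((max dstar 1 : ℕ) : ℝ) (Real.log n) / θ ^ 2))) := by
  obtain ⟨C, K, hC, hK, hcost⟩ := exists_cost_bounds.{u, v} hδ₀ hc
  refine ⟨C, K, hC, hK, ?_⟩
  intro X _ _ _ B _ U _ F H γ₀ ε₀ m₀ d dstar W D _ δ n θ T d' errStar evalTime hF hγ hε hlt hm₀
    hH hdual hW hδ hn1 heven hE hθ hT hd' hstar
  have hn : 2 ≤ n := by
    obtain ⟨k, rfl⟩ := heven
    omega
  have hθ0 : 0 < θ := by rw [hθ]; linarith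
  have hθ1 : θ ≤ 1 / 2 := by rw [hθ]; linarith [hγ.2, hε.1]
  rw [numCombined_eq] at hT
  subst hT
  refine ⟨one_sub_le_measure_err_le hW hF hγ.1.le hδ₀ hδ hθ hθ0 hθ1 hH.le hdual.le hn heven D hd'
    hstar, fun S seed => ⟨exists_agnosticBoost_val evalTime S W m₀ θ δ δ₀ dstar seed hn hθ0 hδ hδ₀,
    hcost evalTime S W m₀ θ δ d dstar seed hn hθ0 hθ1 hm₀ hE hδ⟩⟩
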